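/- **Definitions.** A *hedonic diversity game* has a set $N=[n]$ of agents partitioned into nonempty color classes $D_1,\dots,D_\gamma$. The *palette* of a nonempty set $X\subseteq N$ is $\left(\frac{|D_c\cap X|}{|X|}\right)_{c\in[\gamma]}$. There is a set $M$ of weak orders (total preorders) over the set of all palettes of nonempty subsets of $N$, and every agent $i$ is assigned a weak order $\succeq_i\,\in M$ (not necessarily surjectively); the *number of agent types* is $\tau=|M|$. For nonempty $X,Y\subseteq N$ write $X\succeq_i Y$ if the palette of $X$ is $\succeq_i$ the palette of $Y$. An *outcome* is a partition $\Pi$ of $N$ into nonempty coalitions; $\Pi_i$ is the coalition containing $i$; a coalition is *trivial* if it has exactly one member. Agent $i$ has an *NS-deviation* to $C\in\Pi\cup\{\emptyset\}$ if $C\cup\{i\}\succ_i\Pi_i$; this is an *IS-deviation* if moreover $C\cup\{i\}\succeq_j C$ for every $j\in C$. An outcome is *Nash stable* (*individually stable*) if no agent has an NS-deviation (IS-deviation). The problem HDG-Nash (HDG-Individual): given the agents and their colors, integers $\sigma,\rho_{\ge1},\rho_{\ge2}$, and an oracle that compares any two nonempty coalitions according to $\succeq_i$ for each agent $i$, decide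 whether there is a Nash stable (individually stable) outcome with at most $\rho_{\ge1}$ coalitions, of which at most $\rho_{\ge2}$ are non-trivial, and all of size at most $\sigma$. Such a problem, given by an oracle, is called *NP-hard* on a class of instances if for every $L\in\mathrm{NP}$ there is a map $x\mapsto F(x)$ from binary words to instances in the class such that $x\in L$ if and only if $F(x)$ is a yes-instance, the explicit part of $F(x)$ (agents, colors, integers) is computable from $x$ in polynomial time, and the answers of the preference oracle of $F(x)$ are computable from $x$ and the query in time polynomial in the lengths of $x$ and the query. **Theorem.** HDG-Nash is NP-hard even when restricted to instances with $\tau=\rho_{\ge2}=2$ and $\rho_{\ge1}=3$. HDG-Individual is NP-hard even when restricted to instances with $\tau=4$ and $\rho_{\ge1}=\rho_{\ge2}=3$. -/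

import Mathlib

/-! ### Polynomial time and NP

Polynomial-time computability is Mathlib's `Turing.TM2ComputableInPolyTime`, relative to explicit
encodings of the arguments and of the values as finite words. -/

/-- Encoding of a pair of binary words: the first word, a separator, the second word. -/
def encodePair (p : List Bool × List Bool) : List (Option Bool) :=
  p.1.map some ++ none :: p.2.map some

/-- The class NP of languages of binary words, defined by polynomial-time verifiers and
certificates of polynomially bounded length. -/
def InNP (L : Set (List Bool)) : Prop :=
  ∃ (p : Polynomial ℕ) (V : List Bool × List Bool → Bool),
    Nonempty (Turing.TM2ComputableInPolyTime encodePair (fun b : Bool => [b]) V) ∧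
    ∀ x, x ∈ L ↔ ∃ w : List Bool, w.length ≤ p.eval x.length ∧ V (x, w) = true

/-! ### Hedonic diversity games -/

/-- The palette of a set `X` of agents: for each color `c`, the fraction `|D_c ∩ X| / |X|`, where
`D_c` is the set of agents of color `c`. It is used only for nonempty `X`. -/
def palette {n γ : ℕ} (color : Fin n → Fin γ) (X : Finset (Fin n)) : Fin γ → ℚ :=
  fun c => ((X.filter fun i => color i = c).card : ℚ) / (X.card : ℚ)

/-- The set of all palettes of nonempty sets of agents, as a type. -/
def PaletteOf {n γ : ℕ} (color : Fin n → Fin γ) : Type :=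
  {p : Fin γ → ℚ // ∃ X : Finset (Fin n), X.Nonempty ∧ palette color X = p}

/-- A weak order (total preorder) on `α`; `rel p q` reads "`p` is at least as good as `q`". -/
@[ext]
structure WeakOrder (α : Type) where
  rel : α → α → Prop
  total : ∀ p q, rel p q ∨ rel q p
  trans : ∀ p q r, rel p q → rel q r → rel p r

/-- An instance: agents `Fin n` partitioned into `γ` (nonempty) color classes, a set `M` of weak
orders over the set of all palettes, a (not necessarily surjective) assignment of a member of `M`
to each agent, and the integers bounding the size of coalitions, the number of coalitions and the
number of non-trivial coalitions. -/
structure HDGInstance where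
  n : ℕ
  γ : ℕ
  color : Fin n → Fin γ
  color_surjective : Function.Surjective color
  M : Set (WeakOrder (PaletteOf color))
  pref : Fin n → WeakOrder (PaletteOf color)
  pref_mem : ∀ i, pref i ∈ M
  /-- maximum size of a coalition -/
  maxSize : ℕ
  /-- maximum number of coalitions -/
  maxCoalitions : ℕ
  /-- maximum number of non-trivial coalitions -/
  maxNontrivial : ℕ

namespace HDGInstance

variable (I : HDGInstance)

/-- The number of agent types. -/
noncomputable def numTypes : ℕ := I.M.ncard

/-- A nonempty set of agents. -/
abbrev Coalition : Type := {C : Finset (Fin I.n) // C.Nonempty}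

/-- The palette of a coalition. -/
def pal (C : I.Coalition) : PaletteOf I.color := ⟨palette I.color C.1, C.1, C.2, rfl⟩

/-- Agent `i` weakly prefers `C` to `D`. -/
def WeakPref (i : Fin I.n) (C D : I.Coalition) : Prop := (I.pref i).rel (I.pal C) (I.pal D)

/-- Agent `i` strictly prefers `C` to `D`. -/
def StrictPref (i : Fin I.n) (C D : I.Coalition) : Prop := I.WeakPref i C D ∧ ¬ I.WeakPref i D C

/-- An outcome: a partition of the set of agents into nonempty coalitions. -/
abbrev Outcome : Type := Finpartition (Finset.univ : Finset (Fin I.n))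

/-- The coalition `C ∪ {i}`. -/
def join (i : Fin I.n) (C : Finset (Fin I.n)) : I.Coalition :=
  ⟨insert i C, Finset.insert_nonempty i C⟩

/-- The coalition of agent `i` in the outcome `P`. -/
def coalitionOf (P : I.Outcome) (i : Fin I.n) : I.Coalition :=
  ⟨P.part i, ⟨i, P.mem_part (Finset.mem_univ i)⟩⟩

/-- Agent `i` admits an NS-deviation from `P` to `C`, where `C` is a coalition of `P` or empty. -/
def NSDeviation (P : I.Outcome) (i : Fin I.n) (C : Finset (Fin I.n)) : Prop :=
  (C ∈ P.parts ∨ C = ∅) ∧ I.StrictPref i (I.join i C) (I.coalitionOf P i)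

/-- An NS-deviation that every member `j` of the joined coalition `C` weakly welcomes. -/
def ISDeviation (P : I.Outcome) (i : Fin I.n) (C : Finset (Fin I.n)) : Prop :=
  I.NSDeviation P i C ∧ ∀ (j : Fin I.n) (hj : j ∈ C), I.WeakPref j (I.join i C) ⟨C, ⟨j, hj⟩⟩

/-- Nash stability. -/
def NashStable (P : I.Outcome) : Prop := ∀ i C, ¬ I.NSDeviation P i C

/-- Individual stability. -/
def IndividuallyStable (P : I.Outcome) : Prop := ∀ i C, ¬ I.ISDeviation P i C

/-- The outcome respects the three bounds given with the instance. A coalition is trivial if it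
has exactly one member. -/
def Admissible (P : I.Outcome) : Prop :=
  P.parts.card ≤ I.maxCoalitions ∧
  (P.parts.filter fun C => C.card ≠ 1).card ≤ I.maxNontrivial ∧
  ∀ C ∈ P.parts, C.card ≤ I.maxSize

/-- Yes-instances of HDG-Nash. -/
def NashYes : Prop := ∃ P : I.Outcome, I.Admissible P ∧ I.NashStable P

/-- Yes-instances of HDG-Individual. -/
def IndividualYes : Prop := ∃ P : I.Outcome, I.Admissible P ∧ I.IndividuallyStable P

/-! ### Input format: explicit part and preference oracle -/

/-- The number `k` in unary. Hardness for unary numbers is at least as strong as for binary. -/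
def encodeUnary (k : ℕ) : List Bool := List.replicate k true ++ [false]

/-- The explicit part of the input: everything but the preferences. -/
def encode : List Bool :=
  encodeUnary I.n ++ encodeUnary I.γ ++ encodeUnary I.maxSize ++ encodeUnary I.maxCoalitions ++
    encodeUnary I.maxNontrivial ++ (List.ofFn fun i => encodeUnary (I.color i)).flatten

/-- A query to the preference oracle: an agent and two coalitions to be compared. -/
abbrev Query : Type := Fin I.n × I.Coalition × I.Coalition

open Classical in
/-- The answer of the preference oracle: does the agent weakly prefer the first coalition? -/
noncomputable def oracle (q : I.Query) : Bool := decide (I.WeakPref q.1 q.2.1 q.2.2)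

/-- A set of agents as its characteristic word of length `n`. -/
def encodeSet (C : Finset (Fin I.n)) : List Bool := List.ofFn fun i => decide (i ∈ C)

/-- Encoding of a query: the agent's number in unary and the two characteristic words. -/
def encodeQuery (q : I.Query) : List (Option Bool) :=
  (encodeUnary q.1).map some ++ none :: (I.encodeSet q.2.1.1).map some ++
    none :: (I.encodeSet q.2.2.1).map some

end HDGInstance

/-- The family `F` of instances, indexed by binary words `x`, is constructible in polynomial time
in the oracle model: the explicit part of `F x` can be computed from `x` in polynomial time, and
the preference oracle of `F x` can be implemented in polynomial time, i.e. its answer to a query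
can be computed in time polynomial in the lengths of `x` and the query. -/
def PolyTimeConstructible (F : List Bool → HDGInstance) : Prop :=
  Nonempty (Turing.TM2ComputableInPolyTime (id : List Bool → List Bool) HDGInstance.encode F) ∧
  Nonempty (Turing.TM2ComputableInPolyTime
    (fun a : (Σ x : List Bool, (F x).Query) => a.1.map some ++ none :: (F a.1).encodeQuery a.2)
    (fun b : Bool => [b])
    (fun a => (F a.1).oracle a.2))

/-- The problem of deciding `Yes` is NP-hard (in the oracle model, under polynomial-time many-one
reductions) even when restricted to the instances that satisfy `R`. -/
def NPHardRestricted (Yes R : HDGInstance → Prop) : Prop :=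
  ∀ L : Set (List Bool), InNP L →
    ∃ F : List Bool → HDGInstance, PolyTimeConstructible F ∧ (∀ x, R (F x)) ∧
      ∀ x, x ∈ L ↔ Yes (F x)

/-! ### Games whose preferences evaluate a predicate on words

The agents are a guard `0`, two leaders `1` and `2`, and `m` further agents, called bits. All
colors are different, so that palettes correspond to coalitions. -/

/-! The reduction builds a game whose stable outcomes are certificates. With pairwise different
colors a palette determines the coalition, so a preference may depend on the coalition in any way,
in particular on a run of the NP verifier on the word formed by its bits.

At most three coalitions are allowed. The guard insists on being alone and the two leaders insist on
being separated, so in a stable outcome these three agents occupy three different coalitions, and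
every bit must join one of the leaders. The second leader refuses to have all bits, so the first one
has a nonempty set of them, and tolerates it only if it is accepted. Leaving for the empty coalition
is what enforces all this; as nobody can veto such a move, the argument covers individual stability
too (`exists_accepted_of_stable`). Conversely, an accepted nonempty set of bits gives an outcome in
which every agent has the best value available to it, hence a Nash stable one
(`nashStable_wordOutcome`).

Both proofs use the values of an agent only on coalitions containing it. Hence `value`, with two
distinct orders, and `ownValue`, with four, serve equally well; they yield the two required numbers
of types.

Certificates of length at most `b` are turned into words of length exactly `b + 1` by appending
`true` and then a padding of `false` (`exists_word_iff_exists_certificate`).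

The rest is machine construction (`polyTimeConstructible_reduction`). One machine evaluates the
polynomial in unary and writes the explicit part of the instance. Another one answers a query by
running the verifier once for each of the two coalitions and comparing two values of a finite
profile. -/

namespace BitGame

open Finset

/-- What the agents know about a coalition: whether the guard and the leaders belong to it, whether
some and whether all bits belong to it, and whether its set of bits is accepted. -/
structure Profile where
  guard : Bool
  left : Bool
  right : Bool
  some : Bool
  all : Bool
  accepted : Bool
  deriving DecidableEq, Fintype

namespace Profile

/-- Is an agent with role `c` present? -/
def has (f : Profile) : Fin 4 → Bool
  | 0 => f.guard
  | 1 => f.left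
  | 2 => f.right
  | 3 => f.some

/-- The guard wants to be alone. -/
def guardValue (f : Profile) : ℕ := if f.guard && !f.left && !f.right && !f.some then 1 else 0

/-- The leaders want to be separated, the first one without bits or with an accepted set of bits,
the second one without all bits. -/
def leaderValue (f : Profile) : ℕ :=
  if f.left then
    if f.right then 0 else if f.some then if f.accepted then 2 else 0 else 1
  else if f.right then if f.all then 0 else 1 else 0

/-- Values for two types of agents: leaders and others. -/
def value (c : Fin 4) (f : Profile) : ℕ :=
  if c = 1 ∨ c = 2 then f.leaderValue else f.guardValue

/-- Values for four types of agents. -/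
def ownValue (c : Fin 4) (f : Profile) : ℕ := if f.has c then f.value c else 0

end Profile

/-! ### The game, its number of types and its stable outcomes. -/

section Game

variable {m : ℕ}

/-- The bits of a coalition, as a word. -/
def bits (X : Finset (Fin (m + 3))) : List Bool := List.ofFn fun i : Fin m => i.succ.succ.succ ∈ X

/-- The profile of a word consisting of three particular symbols and a rest. -/
def wordProfile (acc : List Bool → Bool) (a b c : Bool) (r : List Bool) : Profile :=
  ⟨a, b, c, r.any id, r.all id, acc r⟩

/-- The profile of a coalition. -/
def profile (acc : List Bool → Bool) (X : Finset (Fin (m + 3))) : Profile :=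
  wordProfile acc (0 ∈ X) (1 ∈ X) (2 ∈ X) (bits X)

/-- The largest element of `Fin 4` that is at most `n`. -/
def cap (n : ℕ) : Fin 4 := ⟨min n 3, by omega⟩

/-- The guard, the leaders and the bits have the roles `0`, `1`, `2` and `3`. -/
def role (i : Fin (m + 3)) : Fin 4 := cap i

/-- The set of agents with a given palette. -/
def support (p : PaletteOf (id : Fin (m + 3) → Fin (m + 3))) : Finset (Fin (m + 3)) :=
  univ.filter fun i => p.1 i ≠ 0

/-- The weak order given by a value. -/
def order (acc : List Bool → Bool) (u : Profile → ℕ) :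
    WeakOrder (PaletteOf (id : Fin (m + 3) → Fin (m + 3))) where
  rel p q := u (profile acc (support q)) ≤ u (profile acc (support p))
  total _ _ := le_total _ _
  trans _ _ _ h h' := h'.trans h

/-- The game in which the agents with role `c` have the values `u c`. -/
def game (m : ℕ) (acc : List Bool → Bool) (u : Fin 4 → Profile → ℕ) (k : ℕ) : HDGInstance where
  n := m + 3
  γ := m + 3
  color := id
  color_surjective := Function.surjective_id
  M := Set.range fun c => order acc (u c)
  pref i := order acc (u (role i))
  pref_mem i := ⟨role i, rfl⟩
  maxSize := m + 3
  maxCoalitions := 3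
  maxNontrivial := k

/-- This is why pairwise different colors make coalitions and palettes interchangeable: the members
are the colors with a nonzero share. -/
theorem palette_id_ne_zero_iff {n : ℕ} (X : Finset (Fin n)) (i : Fin n) :
    palette (id : Fin n → Fin n) X i ≠ 0 ↔ i ∈ X := by
  by_cases hi : i ∈ X
  · have : (X.card : ℚ) ≠ 0 := by
      exact_mod_cast (card_pos.2 ⟨i, hi⟩).ne'
    simp [palette, hi, this]
  · simp [palette, hi]

variable (acc : List Bool → Bool) (u : Fin 4 → Profile → ℕ) (k : ℕ)

theorem support_pal (C : (game m acc u k).Coalition) : support ((game m acc u k).pal C) = C.1 := by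
  ext i
  simp only [support, mem_filter, mem_univ, true_and]
  exact palette_id_ne_zero_iff C.1 i

theorem weakPref_iff (i : Fin (m + 3)) (C D : (game m acc u k).Coalition) :
    (game m acc u k).WeakPref i C D ↔
      u (role i) (profile acc D.1) ≤ u (role i) (profile acc C.1) := by
  change u (role i) (profile acc (support ((game m acc u k).pal D))) ≤
    u (role i) (profile acc (support ((game m acc u k).pal C))) ↔ _
  rw [support_pal, support_pal]

theorem strictPref_iff (i : Fin (m + 3)) (C D : (game m acc u k).Coalition) :
    (game m acc u k).StrictPref i C D ↔
      u (role i) (profile acc D.1) < u (role i) (profile acc C.1) := by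
  refine (and_congr (weakPref_iff acc u k i C D) (not_congr (weakPref_iff acc u k i D C))).trans ?_
  omega

theorem any_bits (X : Finset (Fin (m + 3))) :
    (bits X).any id = true ↔ ∃ i : Fin m, i.succ.succ.succ ∈ X := by
  simp [bits, List.any_eq_true, List.mem_ofFn]

theorem all_bits (X : Finset (Fin (m + 3))) :
    (bits X).all id = true ↔ ∀ i : Fin m, i.succ.succ.succ ∈ X := by
  simp [bits, List.all_eq_true, List.mem_ofFn]

theorem agent_cases (i : Fin (m + 3)) :
    i = 0 ∨ i = 1 ∨ i = 2 ∨ ∃ j : Fin m, i = j.succ.succ.succ := by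
  obtain ⟨i, hi⟩ := i
  rcases i with _ | _ | _ | i
  · exact .inl rfl
  · exact .inr (.inl rfl)
  · exact .inr (.inr (.inl rfl))
  · exact .inr (.inr (.inr ⟨⟨i, by omega⟩, rfl⟩))

theorem role_succ (j : Fin m) : role j.succ.succ.succ = 3 := by
  ext; simp [role, cap]

theorem has_role {X : Finset (Fin (m + 3))} {i : Fin (m + 3)} (hi : i ∈ X) :
    (profile acc X).has (role i) = true := by
  rcases agent_cases i with rfl | rfl | rfl | ⟨j, rfl⟩
  · exact decide_eq_true hi
  · exact decide_eq_true hi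
  · exact decide_eq_true hi
  · rw [role_succ]
    exact (any_bits X).2 ⟨j, hi⟩

theorem guard_ne_left : (0 : Fin (m + 3)) ≠ 1 := fun h =>
  absurd (congrArg Fin.val h) (show 0 ≠ 1 by decide)

theorem guard_ne_right : (0 : Fin (m + 3)) ≠ 2 := fun h =>
  absurd (congrArg Fin.val h) (show 0 ≠ 2 by decide)

theorem left_ne_right : (1 : Fin (m + 3)) ≠ 2 := fun h =>
  absurd (congrArg Fin.val h) (show 1 ≠ 2 by decide)

theorem any_bits_singleton {i : Fin (m + 3)} (hi : i.1 < 3) : (bits {i}).any id = false := by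
  refine Bool.eq_false_iff.2 fun h => ?_
  obtain ⟨j, hj⟩ := (any_bits _).1 h
  rw [mem_singleton] at hj
  rw [← hj] at hi
  simp only [Fin.val_succ] at hi
  omega

/-- Without bits, "all bits are present" would hold vacuously, and the second leader would not be
content alone; hence `0 < m`. -/
theorem all_bits_singleton (hm : 0 < m) {i : Fin (m + 3)} (hi : i.1 < 3) :
    (bits {i}).all id = false :=
  Bool.eq_false_iff.2 fun h => Bool.eq_false_iff.1 (any_bits_singleton hi)
    ((any_bits _).2 ⟨⟨0, hm⟩, (all_bits _).1 h _⟩)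

theorem profile_singleton_zero (hm : 0 < m) : profile acc ({0} : Finset (Fin (m + 3))) =
    ⟨true, false, false, false, false, acc (bits {(0 : Fin (m + 3))})⟩ := by
  have hi : (0 : Fin (m + 3)).1 < 3 := show 0 < 3 by decide
  simp only [profile, wordProfile, any_bits_singleton hi, all_bits_singleton hm hi, mem_singleton,
    guard_ne_left.symm, guard_ne_right.symm, decide_true, decide_false]

theorem profile_singleton_one (hm : 0 < m) : profile acc ({1} : Finset (Fin (m + 3))) =
    ⟨false, true, false, false, false, acc (bits {(1 : Fin (m + 3))})⟩ := by
  have hi : (1 : Fin (m + 3)).1 < 3 := show 1 < 3 by decide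
  simp only [profile, wordProfile, any_bits_singleton hi, all_bits_singleton hm hi, mem_singleton,
    guard_ne_left, left_ne_right.symm, decide_true, decide_false]

theorem profile_singleton_two (hm : 0 < m) : profile acc ({2} : Finset (Fin (m + 3))) =
    ⟨false, false, true, false, false, acc (bits {(2 : Fin (m + 3))})⟩ := by
  have hi : (2 : Fin (m + 3)).1 < 3 := show 2 < 3 by decide
  simp only [profile, wordProfile, any_bits_singleton hi, all_bits_singleton hm hi, mem_singleton,
    guard_ne_right, left_ne_right, decide_true, decide_false]

/-! ### The number of types -/

theorem le_iff_of_order_eq {v w : Profile → ℕ} (h : order (m := m) acc v = order acc w)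
    {X Y : Finset (Fin (m + 3))} (hX : X.Nonempty) (hY : Y.Nonempty) :
    v (profile acc X) ≤ v (profile acc Y) ↔ w (profile acc X) ≤ w (profile acc Y) := by
  have hs := fun C => support_pal acc (fun _ => v) 0 (m := m) C
  have := congrArg (fun o => o.rel ((game m acc (fun _ => v) 0).pal ⟨Y, hY⟩)
    ((game m acc (fun _ => v) 0).pal ⟨X, hX⟩)) h
  simp only [order, hs] at this
  exact iff_of_eq this

theorem numTypes_value (hm : 0 < m) : (game m acc (fun c f => f.value c) k).numTypes = 2 := by
  have h : (Set.range fun c => order (m := m) acc fun f => f.value c) =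
      {order acc Profile.guardValue, order acc Profile.leaderValue} := by
    ext o
    simp only [Set.mem_range, Set.mem_insert_iff, Set.mem_singleton_iff]
    constructor
    · rintro ⟨c, rfl⟩
      fin_cases c
      exacts [.inl rfl, .inr rfl, .inr rfl, .inl rfl]
    · rintro (rfl | rfl)
      exacts [⟨0, rfl⟩, ⟨1, rfl⟩]
  change (Set.range fun c => order (m := m) acc fun f => f.value c).ncard = 2
  rw [h]
  refine Set.ncard_pair fun h => ?_
  -- The guard's order puts `{0}` strictly above `{1}`, the leaders' order does the reverse.
  have := le_iff_of_order_eq acc h (singleton_nonempty 0) (singleton_nonempty 1)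
  rw [profile_singleton_zero acc hm, profile_singleton_one acc hm] at this
  exact absurd (this.2 (by simp [Profile.leaderValue])) (by simp [Profile.guardValue])

/-- The singletons `{0}`, `{1}`, `{2}` distinguish the orders: each of the roles `0`, `1`, `2` puts
its own singleton strictly above the other two, while role `3` is indifferent among them. -/
theorem numTypes_ownValue (hm : 0 < m) :
    (game m acc (fun c f => f.ownValue c) k).numTypes = 4 := by
  have hinj : Function.Injective fun c => order (m := m) acc fun f => f.ownValue c := by
    intro c c' h
    have h₀₁ := le_iff_of_order_eq acc h (singleton_nonempty 0) (singleton_nonempty 1)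
    have h₁₀ := le_iff_of_order_eq acc h (singleton_nonempty 1) (singleton_nonempty 0)
    have h₀₂ := le_iff_of_order_eq acc h (singleton_nonempty 0) (singleton_nonempty 2)
    have h₂₀ := le_iff_of_order_eq acc h (singleton_nonempty 2) (singleton_nonempty 0)
    rw [profile_singleton_zero acc hm, profile_singleton_one acc hm] at h₀₁ h₁₀
    rw [profile_singleton_zero acc hm, profile_singleton_two acc hm] at h₀₂ h₂₀
    revert h₀₁ h₁₀ h₀₂ h₂₀
    -- Whether the empty set of bits is accepted plays no role; abstracting it leaves a finite
    -- check.
    generalize acc _ = a₀, acc _ = a₁, acc _ = a₂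
    clear h
    revert c c' a₀ a₁ a₂
    decide
  change (Set.range fun c => order (m := m) acc fun f => f.ownValue c).ncard = 4
  rw [← Set.image_univ, Set.ncard_image_of_injective _ hinj, Set.ncard_univ]
  simp

/-! ### Stable outcomes -/

/-- The coalition of an agent in the outcome given by a word: the guard is alone, the agents whose
bit is set are with the first leader, the other ones with the second leader. -/
def side (r : Fin m → Bool) : Fin (m + 3) → Fin 3 :=
  Fin.cons 0 (Fin.cons 1 (Fin.cons 2 fun j => if r j then 1 else 2))

open Classical in
/-- The outcome given by a word. -/
noncomputable def wordOutcome (r : Fin m → Bool) : Finpartition (univ : Finset (Fin (m + 3))) :=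
  Finpartition.ofSetoid (Setoid.ker (side r))

open Classical in
theorem mem_part_wordOutcome (r : Fin m → Bool) (i j : Fin (m + 3)) :
    j ∈ (wordOutcome r).part i ↔ side r i = side r j := by
  rw [wordOutcome, Finpartition.mem_part_ofSetoid_iff_rel, Setoid.ker_def]

/-- A coalition of the outcome given by a word. -/
def sideSet (r : Fin m → Bool) (c : Fin 3) : Finset (Fin (m + 3)) := univ.filter (side r · = c)

theorem part_wordOutcome (r : Fin m → Bool) (i : Fin (m + 3)) :
    (wordOutcome r).part i = sideSet r (side r i) := by
  ext j
  rw [mem_part_wordOutcome, sideSet, mem_filter, eq_comm]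
  simp

theorem exists_eq_sideSet {r : Fin m → Bool} {C : Finset (Fin (m + 3))}
    (hC : C ∈ (wordOutcome r).parts) : ∃ c, C = sideSet r c := by
  obtain ⟨i, hi⟩ := (wordOutcome r).nonempty_of_mem_parts hC
  exact ⟨side r i, by rw [← part_wordOutcome, (wordOutcome r).part_eq_of_mem hC hi]⟩

theorem card_parts_wordOutcome (r : Fin m → Bool) : (wordOutcome r).parts.card ≤ 3 := by
  have : (wordOutcome r).parts ⊆ univ.image (sideSet r) := fun C hC => by
    obtain ⟨c, rfl⟩ := exists_eq_sideSet hC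
    exact mem_image_of_mem _ (mem_univ _)
  exact (card_le_card this).trans (card_image_le.trans (by simp))

theorem sideSet_zero (r : Fin m → Bool) : sideSet r 0 = {0} := by
  ext i
  rw [sideSet, mem_filter, mem_singleton]
  simp only [mem_univ, true_and]
  rcases agent_cases i with rfl | rfl | rfl | ⟨j, rfl⟩
  · simp [side]
  · exact ⟨fun h => absurd h (by change ¬ (1 : Fin 3) = 0; decide), fun h => absurd h (by simp)⟩
  · exact ⟨fun h => absurd h (by change ¬ (2 : Fin 3) = 0; decide),
      fun h => absurd (congrArg Fin.val h) (by
        change ¬ 2 % (m + 3) = 0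
        rw [Nat.mod_eq_of_lt (by omega)]
        decide)⟩
  · refine ⟨fun h => ?_, fun h => absurd h (Fin.succ_ne_zero _)⟩
    change (if r j then (1 : Fin 3) else 2) = 0 at h
    split at h <;> exact absurd h (by decide)

theorem card_nontrivial_wordOutcome (r : Fin m → Bool) :
    ((wordOutcome r).parts.filter fun C => C.card ≠ 1).card ≤ 2 := by
  have : ((wordOutcome r).parts.filter fun C => C.card ≠ 1) ⊆ {sideSet r 1, sideSet r 2} := by
    intro C hC
    rw [mem_filter] at hC
    obtain ⟨c, rfl⟩ := exists_eq_sideSet hC.1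
    fin_cases c
    · exact absurd (by change (sideSet r 0).card = 1; rw [sideSet_zero]; rfl) hC.2
    · simp
    · simp
  exact (card_le_card this).trans card_le_two

variable {acc u k}

theorem bits_sideSet_one (r : Fin m → Bool) : bits (sideSet r 1) = List.ofFn r := by
  refine congrArg List.ofFn (funext fun j => ?_)
  have : side r j.succ.succ.succ = if r j then 1 else 2 := rfl
  simp only [sideSet, mem_filter, mem_univ, true_and, this]
  cases r j <;> simp

/-- A word that is accepted gives a stable outcome. -/
theorem nashStable_wordOutcome (hu : ∀ c f, f.has c = true → u c f = f.value c) {r : Fin m → Bool}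
    (hr : (List.ofFn r).any id = true) (hacc : acc (List.ofFn r) = true) :
    (game m acc u k).NashStable (wordOutcome r) := by
  rintro (i : Fin (m + 3)) (C : Finset (Fin (m + 3))) ⟨hC, hlt⟩
  replace hlt := (strictPref_iff acc u k i _ _).1 hlt
  change u (role i) (profile acc ((wordOutcome r).part i)) <
    u (role i) (profile acc (insert i C)) at hlt
  -- The deviating agent belongs to both coalitions compared, so `u` may be replaced by `value`.
  rw [part_wordOutcome, hu _ _ (has_role acc (mem_insert_self i C)),
    hu _ _ (has_role acc (by rw [sideSet, mem_filter]; exact ⟨mem_univ _, rfl⟩))] at hlt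
  have guard_le : ∀ f : Profile, f.guardValue ≤ 1 := by decide
  have leader_le : ∀ f : Profile, f.leaderValue ≤ 2 := by decide
  have mem_side : ∀ j c, j ∈ sideSet r c ↔ side r j = c := fun j c => by simp [sideSet]
  rcases agent_cases i with rfl | rfl | rfl | ⟨j, rfl⟩
  · have h : (profile acc (sideSet r 0)).guardValue = 1 := by
      have h₁ : (profile acc (sideSet r 0)).guard = true := by
        exact decide_eq_true ((mem_side 0 0).2 rfl)
      have h₂ : (profile acc (sideSet r 0)).left = false :=
        decide_eq_false fun h => absurd ((mem_side 1 0).1 h) (by change (1 : Fin 3) ≠ 0; decide)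
      have h₃ : (profile acc (sideSet r 0)).right = false :=
        decide_eq_false fun h => absurd ((mem_side 2 0).1 h) (by change (2 : Fin 3) ≠ 0; decide)
      have h₄ : (profile acc (sideSet r 0)).some = false := by
        refine Bool.eq_false_iff.2 fun h => ?_
        obtain ⟨j, hj⟩ := (any_bits _).1 h
        rw [sideSet_zero, mem_singleton] at hj
        exact Fin.succ_ne_zero _ hj
      simp [Profile.guardValue, h₁, h₂, h₃, h₄]
    exact absurd (guard_le (profile acc (insert 0 C))) (not_le.2 (h.symm.trans_lt hlt))
  · have h : (profile acc (sideSet r 1)).leaderValue = 2 := by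
      have h₁ : (profile acc (sideSet r 1)).left = true := by
        exact decide_eq_true ((mem_side 1 1).2 rfl)
      have h₂ : (profile acc (sideSet r 1)).right = false :=
        decide_eq_false fun h => absurd ((mem_side 2 1).1 h) (by change (2 : Fin 3) ≠ 1; decide)
      have h₃ : (profile acc (sideSet r 1)).some = true := by
        change (bits _).any id = true
        rwa [bits_sideSet_one]
      have h₄ : (profile acc (sideSet r 1)).accepted = true := by
        change acc (bits _) = true
        rwa [bits_sideSet_one]
      simp [Profile.leaderValue, h₁, h₂, h₃, h₄]
    exact absurd (leader_le (profile acc (insert 1 C))) (not_le.2 (h.symm.trans_lt hlt))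
  · have h : (profile acc (sideSet r 2)).leaderValue = 1 := by
      have h₁ : (profile acc (sideSet r 2)).left = false :=
        decide_eq_false fun h => absurd ((mem_side 1 2).1 h) (by change (1 : Fin 3) ≠ 2; decide)
      have h₂ : (profile acc (sideSet r 2)).right = true := by
        exact decide_eq_true ((mem_side 2 2).2 rfl)
      -- By `hr` some bit is with the first leader, hence missing here.
      have h₃ : (profile acc (sideSet r 2)).all = false := by
        refine Bool.eq_false_iff.2 fun h => ?_
        rw [← bits_sideSet_one] at hr
        obtain ⟨j, hj⟩ := (any_bits _).1 hr
        have hj' := (all_bits _).1 h j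
        rw [mem_side] at hj hj'
        exact absurd (hj.symm.trans hj') (by decide)
      simp [Profile.leaderValue, h₁, h₂, h₃]
    -- The value `2` requires the absence of the second leader, who therefore cannot attain it.
    have le_one : ∀ f : Profile, f.right = true → f.leaderValue ≤ 1 := by decide
    exact absurd (le_one (profile acc (insert 2 C)) (decide_eq_true (mem_insert_self _ _)))
      (not_le.2 (h.symm.trans_lt hlt))
  -- Bits share the guard's values, which vanish on every coalition containing a bit, so a bit never
  -- gains by moving.
  · have eq_zero : ∀ f : Profile, f.some = true → f.guardValue = 0 := by decide
    rw [role_succ] at hlt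
    refine Nat.not_lt_zero _ (lt_of_lt_of_eq hlt (eq_zero (profile acc (insert _ C)) ?_))
    exact (any_bits _).2 ⟨j, mem_insert_self _ _⟩

/-- A stable outcome with at most three coalitions gives an accepted word. -/
theorem exists_accepted_of_stable (hu : ∀ c f, f.has c = true → u c f = f.value c) (hm : 0 < m)
    {P : Finpartition (univ : Finset (Fin (m + 3)))} (hP : (game m acc u k).IndividuallyStable P)
    (hcard : P.parts.card ≤ 3) :
    ∃ r : List Bool, r.length = m ∧ r.any id = true ∧ acc r = true := by
  -- Moving to the empty coalition needs nobody's consent, so stability gives every agent at least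
  -- its value when alone. No other deviation is used.
  have hle : ∀ i : Fin (m + 3), (profile acc {i}).value (role i) ≤
      (profile acc (P.part i)).value (role i) := by
    intro i
    by_contra hlt
    refine hP i ∅ ⟨⟨.inr rfl, (strictPref_iff acc u k i _ _).2 ?_⟩, fun j hj => ?_⟩
    · change u (role i) (profile acc (P.part i)) < u (role i) (profile acc (insert i ∅))
      rw [hu _ _ (has_role acc (P.mem_part (mem_univ i))),
        hu _ _ (has_role acc (mem_insert_self i ∅))]
      exact not_le.1 hlt
    · exact absurd hj (notMem_empty j)
  have guard_alone : ∀ f : Profile, f.guardValue = 0 ∨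
      f.left = false ∧ f.right = false ∧ f.some = false := by decide
  have left_happy : ∀ f : Profile, f.left = true → f.leaderValue = 0 ∨
      f.right = false ∧ (f.some = true → f.accepted = true) := by decide
  have right_happy : ∀ f : Profile, f.right = true → f.leaderValue = 0 ∨ f.all = false := by decide
  have mem_part : ∀ i, i ∈ P.part i := fun i => P.mem_part (mem_univ i)
  have h₀ : (profile acc (P.part 0)).guardValue ≠ 0 := by
    have h := hle 0
    change (profile acc ({0} : Finset (Fin (m + 3)))).guardValue ≤ _ at h
    rw [profile_singleton_zero acc hm] at h
    exact (Nat.lt_of_lt_of_le Nat.zero_lt_one h).ne'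
  have h₁ : (profile acc (P.part 1)).leaderValue ≠ 0 := by
    have h := hle 1
    change (profile acc ({1} : Finset (Fin (m + 3)))).leaderValue ≤ _ at h
    rw [profile_singleton_one acc hm] at h
    exact (Nat.lt_of_lt_of_le Nat.zero_lt_one h).ne'
  have h₂ : (profile acc (P.part 2)).leaderValue ≠ 0 := by
    have h := hle 2
    change (profile acc ({2} : Finset (Fin (m + 3)))).leaderValue ≤ _ at h
    rw [profile_singleton_two acc hm] at h
    exact (Nat.lt_of_lt_of_le Nat.zero_lt_one h).ne'
  obtain ⟨h₀₁, h₀₂, h₀₃⟩ := (guard_alone _).resolve_left h₀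
  obtain ⟨h₁₂, hacc⟩ := (left_happy _ (decide_eq_true (mem_part 1))).resolve_left h₁
  have hall := (right_happy _ (decide_eq_true (mem_part 2))).resolve_left h₂
  replace h₀₁ : 1 ∉ P.part 0 := of_decide_eq_false h₀₁
  replace h₀₂ : 2 ∉ P.part 0 := of_decide_eq_false h₀₂
  replace h₁₂ : 2 ∉ P.part 1 := of_decide_eq_false h₁₂
  by_cases hsome : (profile acc (P.part 1)).some = true
  · exact ⟨bits (P.part 1), by simp [bits], hsome, hacc hsome⟩
  -- If no bit is with the first leader, then all are with the second one: the coalitions of the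
  -- guard and the leaders are distinct and exhaust the three parts, and the guard's contains no
  -- bits.
  exfalso
  refine Bool.eq_false_iff.1 hall ((all_bits _).2 fun j => ?_)
  have hne₀₁ : P.part 0 ≠ P.part 1 := fun h => h₀₁ (h ▸ mem_part 1)
  have hne₀₂ : P.part 0 ≠ P.part 2 := fun h => h₀₂ (h ▸ mem_part 2)
  have hne₁₂ : P.part 1 ≠ P.part 2 := fun h => h₁₂ (h ▸ mem_part 2)
  have hsub : {P.part 0, P.part 1, P.part 2} ⊆ P.parts := by
    intro C hC
    simp only [mem_insert, mem_singleton] at hC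
    rcases hC with rfl | rfl | rfl <;> exact P.part_mem.2 (mem_univ _)
  have heq := eq_of_subset_of_card_le hsub (by
    rwa [card_eq_three.2 ⟨_, _, _, hne₀₁, hne₀₂, hne₁₂, rfl⟩])
  have hj : P.part j.succ.succ.succ ∈ P.parts := P.part_mem.2 (mem_univ _)
  rw [← heq] at hj
  simp only [mem_insert, mem_singleton] at hj
  have hmem := mem_part j.succ.succ.succ
  rcases hj with hj | hj | hj <;> rw [hj] at hmem
  · exact absurd ((any_bits _).2 ⟨j, hmem⟩) (Bool.eq_false_iff.1 h₀₃)
  · exact absurd ((any_bits _).2 ⟨j, hmem⟩) hsome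
  · exact hmem

theorem exists_word_iff_nashYes (hu : ∀ c f, f.has c = true → u c f = f.value c) (hm : 0 < m)
    (hk : 2 ≤ k) : (game m acc u k).NashYes ↔
      ∃ r : List Bool, r.length = m ∧ r.any id = true ∧ acc r = true := by
  constructor
  · rintro ⟨P, ⟨hcard, -⟩, hP⟩
    exact exists_accepted_of_stable hu hm (fun i C h => hP i C h.1) hcard
  · rintro ⟨r, rfl, hr, hacc⟩
    rw [← List.ofFn_get r] at hr hacc
    exact ⟨wordOutcome r.get, ⟨card_parts_wordOutcome _,
      (card_nontrivial_wordOutcome _).trans hk, fun C _ => card_finset_fin_le C⟩,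
      nashStable_wordOutcome hu hr hacc⟩

/-- One direction needs only the moves to the empty coalition, and in the other the Nash stable
outcome is individually stable. -/
theorem exists_word_iff_individualYes (hu : ∀ c f, f.has c = true → u c f = f.value c)
    (hm : 0 < m) (hk : 2 ≤ k) : (game m acc u k).IndividualYes ↔
      ∃ r : List Bool, r.length = m ∧ r.any id = true ∧ acc r = true := by
  constructor
  · rintro ⟨P, ⟨hcard, -⟩, hP⟩
    exact exists_accepted_of_stable hu hm hP hcard
  · intro h
    obtain ⟨P, hP, hs⟩ := (exists_word_iff_nashYes (k := k) hu hm hk).2 h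
    exact ⟨P, hP, fun i C h => hs i C h.1⟩

end Game

end BitGame

/-! ### A calculus of stack-machine programs with time bounds. -/

namespace StackProgram

open Turing Turing.TM2 Turing.TM2.Stmt

variable {K : Type} {Γ : K → Type} {σ : Type}

section Basic

variable [DecidableEq K]

/-! ### Runs of stack machines -/

/-- `Steps M t c d`: the machine `M` goes from `c` to `d` in exactly `t` steps. -/
inductive Steps {Λ : Type} (M : Λ → Stmt Γ Λ σ) : ℕ → Cfg Γ Λ σ → Cfg Γ Λ σ → Prop
  | refl (c) : Steps M 0 c c
  | cons {t l v S d} : Steps M t (stepAux (M l) v S) d → Steps M (t + 1) ⟨some l, v, S⟩ d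

theorem Steps.trans {Λ : Type} {M : Λ → Stmt Γ Λ σ} {t₁ t₂ : ℕ} {a b c : Cfg Γ Λ σ}
    (h₁ : Steps M t₁ a b) (h₂ : Steps M t₂ b c) : Steps M (t₁ + t₂) a c := by
  induction h₁ with
  | refl => simpa using h₂
  | cons _ ih => rw [Nat.add_right_comm]; exact .cons (ih h₂)

theorem iterate_bind_none {α : Type} (f : α → Option α) (t : ℕ) :
    (flip bind f)^[t] none = none := by
  induction t with
  | zero => rfl
  | succ t ih => rw [Function.iterate_succ_apply]; exact ih

theorem steps_iff_iterate {Λ : Type} {M : Λ → Stmt Γ Λ σ} {t : ℕ} {c d : Cfg Γ Λ σ} :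
    Steps M t c d ↔ (flip bind (TM2.step M))^[t] (some c) = some d := by
  constructor
  · intro h
    induction h with
    | refl => rfl
    | cons _ ih => rw [Function.iterate_succ_apply]; exact ih
  · intro h
    induction t generalizing c with
    | zero => cases h; exact .refl _
    | succ t ih =>
      rw [Function.iterate_succ_apply] at h
      obtain ⟨l, v, S⟩ := c
      cases l with
      | none => rw [show flip bind (TM2.step M) (some ⟨none, v, S⟩) = none from rfl,
          iterate_bind_none] at h; cases h
      | some l => exact .cons (ih h)

/-! ### Program fragments and their combinators -/

/-- A program fragment: a stack machine in which halting passes control to whatever comes next. -/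
structure Prog {K : Type} (Γ : K → Type) (σ : Type) where
  Λ : Type
  fintype : Fintype Λ
  main : Λ
  m : Λ → Stmt Γ Λ σ

/-- Started in state `v` with stacks `S`, the fragment `p` halts in state `v'` with stacks `S'`
after at most `T` steps. -/
def Runs (p : Prog Γ σ) (v : σ) (S : ∀ k, List (Γ k)) (v' : σ) (S' : ∀ k, List (Γ k)) (T : ℕ) :
    Prop :=
  ∃ t ≤ T, Steps p.m t ⟨some p.main, v, S⟩ ⟨none, v', S'⟩

theorem Runs.mono {p : Prog Γ σ} {v v' : σ} {S S' : ∀ k, List (Γ k)} {T T' : ℕ}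
    (h : Runs p v S v' S' T) (hT : T ≤ T') : Runs p v S v' S' T' := by
  obtain ⟨t, ht, h⟩ := h
  exact ⟨t, ht.trans hT, h⟩

/-- Rename the labels of a statement by `f` and replace `halt` by `e`. -/
def exitTo {Λ Λ' : Type} (f : Λ → Λ') (e : Stmt Γ Λ' σ) : Stmt Γ Λ σ → Stmt Γ Λ' σ
  | push k g q => push k g (exitTo f e q)
  | peek k g q => peek k g (exitTo f e q)
  | pop k g q => pop k g (exitTo f e q)
  | load g q => load g (exitTo f e q)
  | branch g q₁ q₂ => branch g (exitTo f e q₁) (exitTo f e q₂)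
  | goto g => goto fun v => f (g v)
  | halt => e

/-- The replacement `e` is executed within the same machine step as the statement that would have
halted, so gluing programs costs no additional steps. -/
theorem stepAux_exitTo {Λ Λ' : Type} (f : Λ → Λ') (e : Stmt Γ Λ' σ) (q : Stmt Γ Λ σ) (v : σ)
    (S : ∀ k, List (Γ k)) :
    (∀ l v' S', stepAux q v S = ⟨some l, v', S'⟩ →
      stepAux (exitTo f e q) v S = ⟨some (f l), v', S'⟩) ∧
    (∀ v' S', stepAux q v S = ⟨none, v', S'⟩ → stepAux (exitTo f e q) v S = stepAux e v' S') := by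
  induction q generalizing v S with
  | push k g q ih => exact ih _ _
  | peek k g q ih => exact ih _ _
  | pop k g q ih => exact ih _ _
  | load g q ih => exact ih _ _
  | branch g q₁ q₂ ih₁ ih₂ =>
    simp only [exitTo, stepAux]
    cases g v
    · exact ih₂ _ _
    · exact ih₁ _ _
  | goto g =>
    refine ⟨?_, ?_⟩
    · rintro l v' S' h; cases h; rfl
    · rintro v' S' h; cases h
  | halt =>
    refine ⟨?_, ?_⟩
    · rintro l v' S' h; cases h
    · rintro v' S' h; cases h; rfl

/-- A machine that contains `M` with `halt` replaced by `e` simulates the runs of `M`. -/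
theorem Steps.exitTo {Λ Λ' : Type} {M : Λ → Stmt Γ Λ σ} {M' : Λ' → Stmt Γ Λ' σ} {f : Λ → Λ'}
    {e : Stmt Γ Λ' σ} (hM : ∀ l, M' (f l) = exitTo f e (M l)) {t : ℕ} {l : Λ} {v v' : σ}
    {S S' : ∀ k, List (Γ k)} (h : Steps M t ⟨some l, v, S⟩ ⟨none, v', S'⟩) :
    Steps M' t ⟨some (f l), v, S⟩ (stepAux e v' S') := by
  induction t generalizing l v S with
  | zero => cases h
  | succ t ih =>
    obtain _ | h := h
    refine .cons ?_
    rw [hM]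
    rcases hc : stepAux (M l) v S with ⟨_ | l', w, R⟩
    · rw [hc] at h
      cases h
      rw [(stepAux_exitTo f e (M l) v S).2 _ _ hc]
      exact .refl _
    · rw [hc] at h
      rw [(stepAux_exitTo f e (M l) v S).1 _ _ _ hc]
      exact ih h

/-- A single statement, repeated as long as it ends with `goto`. -/
def rep (s : Stmt Γ Unit σ) : Prog Γ σ := ⟨Unit, inferInstance, (), fun _ => s⟩

theorem Runs.rep_halt {s : Stmt Γ Unit σ} {v v' : σ} {S S' : ∀ k, List (Γ k)}
    (h : stepAux s v S = ⟨none, v', S'⟩) : Runs (rep s) v S v' S' 1 :=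
  ⟨1, le_rfl, .cons (by change Steps _ 0 (stepAux s v S) _; rw [h]; exact .refl _)⟩

theorem Runs.rep_goto {s : Stmt Γ Unit σ} {v v₁ v' : σ} {S S₁ S' : ∀ k, List (Γ k)} {T : ℕ}
    (h : stepAux s v S = ⟨some (), v₁, S₁⟩) (h' : Runs (rep s) v₁ S₁ v' S' T) :
    Runs (rep s) v S v' S' (T + 1) := by
  obtain ⟨t, ht, h'⟩ := h'
  exact ⟨t + 1, Nat.succ_le_succ ht,
    .cons (by change Steps _ t (stepAux s v S) _; rw [h]; exact h')⟩

/-- First `p`, then `q`. -/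
def seq (p q : Prog Γ σ) : Prog Γ σ where
  Λ := p.Λ ⊕ q.Λ
  fintype := @instFintypeSum _ _ p.fintype q.fintype
  main := .inl p.main
  m := Sum.elim (fun l => exitTo .inl (goto fun _ => .inr q.main) (p.m l))
    (fun l => exitTo .inr halt (q.m l))

theorem Runs.seq {p q : Prog Γ σ} {v v₁ v' : σ} {S S₁ S' : ∀ k, List (Γ k)} {T₁ T₂ : ℕ}
    (hp : Runs p v S v₁ S₁ T₁) (hq : Runs q v₁ S₁ v' S' T₂) :
    Runs (seq p q) v S v' S' (T₁ + T₂) := by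
  obtain ⟨t₁, ht₁, hp⟩ := hp
  obtain ⟨t₂, ht₂, hq⟩ := hq
  refine ⟨t₁ + t₂, add_le_add ht₁ ht₂, Steps.trans (b := ⟨some (.inr q.main), v₁, S₁⟩) ?_ ?_⟩
  · exact hp.exitTo (M' := (StackProgram.seq p q).m) (f := .inl)
      (e := goto fun _ => .inr q.main) (fun _ => rfl)
  · exact hq.exitTo (M' := (StackProgram.seq p q).m) (f := .inr) (e := halt) (fun _ => rfl)

/-- Execute `s`; if it ends with `goto`, execute `p` and start again. -/
def loop (s : Stmt Γ Unit σ) (p : Prog Γ σ) : Prog Γ σ where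
  Λ := Option p.Λ
  fintype := @instFintypeOption _ p.fintype
  main := none
  m := fun
    | none => exitTo (fun _ => some p.main) halt s
    | some l => exitTo some (goto fun _ => none) (p.m l)

theorem Runs.loop_halt {s : Stmt Γ Unit σ} {p : Prog Γ σ} {v v' : σ} {S S' : ∀ k, List (Γ k)}
    (h : stepAux s v S = ⟨none, v', S'⟩) : Runs (loop s p) v S v' S' 1 :=
  ⟨1, le_rfl, .cons (by
    change Steps _ 0 (stepAux (exitTo (fun _ => some p.main) halt s) v S) _
    rw [(stepAux_exitTo _ _ s v S).2 _ _ h]; exact .refl _)⟩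

theorem Runs.loop_goto {s : Stmt Γ Unit σ} {p : Prog Γ σ} {v v₁ v₂ v' : σ}
    {S S₁ S₂ S' : ∀ k, List (Γ k)} {T₁ T₂ : ℕ}
    (h : stepAux s v S = ⟨some (), v₁, S₁⟩) (hp : Runs p v₁ S₁ v₂ S₂ T₁)
    (h' : Runs (loop s p) v₂ S₂ v' S' T₂) :
    Runs (loop s p) v S v' S' (T₁ + T₂ + 1) := by
  obtain ⟨t₁, ht₁, hp⟩ := hp
  obtain ⟨t₂, ht₂, h'⟩ := h'
  refine ⟨t₁ + t₂ + 1, by omega, .cons ?_⟩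
  change Steps _ _ (stepAux (exitTo (fun _ => some p.main) halt s) v S) _
  rw [(stepAux_exitTo _ _ s v S).1 _ _ _ h]
  exact Steps.trans (hp.exitTo (M' := (loop s p).m) (f := some)
    (e := goto fun _ => none) (fun _ => rfl)) h'

end Basic

/-! ### Machines with additional stacks and registers -/

/-- The alphabets of two kinds of stacks, put together. -/
abbrev SumAlphabet {K₀ : Type} (Γ : K → Type) (Γ₀ : K₀ → Type) : K ⊕ K₀ → Type
  | .inl k => Γ k
  | .inr k => Γ₀ k

/-- Stacks of two kinds, put together. -/
def join {K₀ : Type} {Γ₀ : K₀ → Type} (S : ∀ k, List (Γ k)) (S₀ : ∀ k, List (Γ₀ k)) :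
    ∀ k, List (SumAlphabet Γ Γ₀ k)
  | .inl k => S k
  | .inr k => S₀ k

section Lift

variable {K₀ : Type} {Γ₀ : K₀ → Type}

@[simp] theorem join_inl (S : ∀ k, List (Γ k)) (S₀ : ∀ k, List (Γ₀ k)) (k : K) :
    join S S₀ (.inl k) = S k := rfl

@[simp] theorem join_inr (S : ∀ k, List (Γ k)) (S₀ : ∀ k, List (Γ₀ k)) (k : K₀) :
    join S S₀ (.inr k) = S₀ k := rfl

variable [DecidableEq K] [DecidableEq K₀]

@[simp] theorem update_join_inl (S : ∀ k, List (Γ k)) (S₀ : ∀ k, List (Γ₀ k)) (k : K)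
    (l : List (Γ k)) :
    Function.update (join S S₀) (.inl k) l = join (Function.update S k l) S₀ := by
  funext j
  rcases j with j | j
  · by_cases h : j = k
    · subst h; simp
    · rw [Function.update_of_ne (by simpa using h)]; simp [h]
  · rw [Function.update_of_ne (by simp)]; rfl

@[simp] theorem update_join_inr (S : ∀ k, List (Γ k)) (S₀ : ∀ k, List (Γ₀ k)) (k : K₀)
    (l : List (Γ₀ k)) :
    Function.update (join S S₀) (.inr k) l = join S (Function.update S₀ k l) := by
  funext j
  rcases j with j | j
  · rw [Function.update_of_ne (by simp)]; rfl
  · by_cases h : j = k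
    · subst h; simp
    · rw [Function.update_of_ne (by simpa using h)]; simp [h]

/-- The same statement on a machine with additional stacks and registers. -/
def liftStmt {Λ : Type} (Γ₀ : K₀ → Type) (ρ : Type) :
    Stmt Γ Λ σ → Stmt (SumAlphabet Γ Γ₀) Λ (σ × ρ)
  | push k g q => push (.inl k) (fun v => g v.1) (liftStmt Γ₀ ρ q)
  | peek k g q => peek (.inl k) (fun v a => (g v.1 a, v.2)) (liftStmt Γ₀ ρ q)
  | pop k g q => pop (.inl k) (fun v a => (g v.1 a, v.2)) (liftStmt Γ₀ ρ q)
  | load g q => load (fun v => (g v.1, v.2)) (liftStmt Γ₀ ρ q)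
  | branch g q₁ q₂ => branch (fun v => g v.1) (liftStmt Γ₀ ρ q₁) (liftStmt Γ₀ ρ q₂)
  | goto g => goto fun v => g v.1
  | halt => halt

theorem stepAux_liftStmt {Λ ρ : Type} (q : Stmt Γ Λ σ) (v : σ) (r : ρ) (S : ∀ k, List (Γ k))
    (S₀ : ∀ k, List (Γ₀ k)) :
    stepAux (liftStmt Γ₀ ρ q) (v, r) (join S S₀) =
      ⟨(stepAux q v S).l, ((stepAux q v S).var, r), join (stepAux q v S).stk S₀⟩ := by
  induction q generalizing v S with
  | push k g q ih =>
    simp only [liftStmt, stepAux]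
    rw [← ih]
    exact congrArg _ (update_join_inl S S₀ k _)
  | peek k g q ih => exact ih _ _
  | pop k g q ih =>
    simp only [liftStmt, stepAux]
    rw [← ih]
    exact congrArg _ (update_join_inl S S₀ k _)
  | load g q ih => exact ih _ _
  | branch g q₁ q₂ ih₁ ih₂ =>
    simp only [liftStmt, stepAux]
    cases g v
    · exact ih₂ _ _
    · exact ih₁ _ _
  | goto g => rfl
  | halt => rfl

/-- The same fragment on a machine with additional stacks and registers. -/
def lift (Γ₀ : K₀ → Type) (ρ : Type) (p : Prog Γ σ) : Prog (SumAlphabet Γ Γ₀) (σ × ρ) :=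
  ⟨p.Λ, p.fintype, p.main, fun l => liftStmt Γ₀ ρ (p.m l)⟩

theorem Runs.lift {ρ : Type} {p : Prog Γ σ} {v v' : σ} {S S' : ∀ k, List (Γ k)} {T : ℕ}
    (h : Runs p v S v' S' T) (r : ρ) (S₀ : ∀ k, List (Γ₀ k)) :
    Runs (lift Γ₀ ρ p) (v, r) (join S S₀) (v', r) (join S' S₀) T := by
  have key : ∀ t (c d : Cfg Γ p.Λ σ), Steps p.m t c d →
      Steps (StackProgram.lift Γ₀ ρ p).m t ⟨c.l, (c.var, r), join c.stk S₀⟩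
        ⟨d.l, (d.var, r), join d.stk S₀⟩ := by
    intro t c d h
    induction h with
    | refl => exact .refl _
    | @cons t l v S d _ ih =>
      refine .cons ?_
      change Steps _ _ (stepAux (liftStmt Γ₀ ρ (p.m l)) (v, r) (join S S₀)) _
      rw [stepAux_liftStmt]
      exact ih
  obtain ⟨t, ht, h⟩ := h
  exact ⟨t, ht, key _ _ _ h⟩

end Lift

/-! ### Bundled machines -/

variable [DecidableEq K]

/-- The program of a bundled machine. -/
def ofFinTM2 (tm : FinTM2) : Prog tm.Γ tm.σ := ⟨tm.Λ, tm.ΛFin, tm.main, tm.m⟩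

/-- All stacks but `k` are empty. -/
def single (k : K) (l : List (Γ k)) : ∀ j, List (Γ j) := Function.update (fun _ => []) k l

theorem dite_eq_single (k : K) (l : List (Γ k)) :
    (fun j => @dite (List (Γ j)) (j = k) _ (fun h => by rw [h]; exact l) fun _ => []) =
      single k l := by
  funext j
  by_cases h : j = k
  · subst h; simp [single]
  · simp [single, h]

/-- A bundled machine must halt in its initial state with all stacks but the output empty. This
makes it a subroutine that can be called repeatedly. -/
theorem runs_of_outputs {tm : FinTM2} {l : List (tm.Γ tm.k₀)} {l' : List (tm.Γ tm.k₁)} {T : ℕ}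
    (h : TM2OutputsInTime tm l (some l') T) :
    Runs (ofFinTM2 tm) tm.initialState (single tm.k₀ l) tm.initialState (single tm.k₁ l') T := by
  obtain ⟨⟨t, h⟩, ht⟩ := h
  refine ⟨t, ht, steps_iff_iterate.2 ?_⟩
  rw [← dite_eq_single, ← dite_eq_single]
  exact h

/-- A program as a bundled machine. -/
def toFinTM2 [Fintype K] [Fintype σ] (p : Prog Γ σ) (k₀ k₁ : K) [Fintype (Γ k₀)] (v₀ : σ) :
    FinTM2 where
  K := K
  k₀ := k₀
  k₁ := k₁
  Γ := Γ
  Λ := p.Λ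
  main := p.main
  ΛFin := p.fintype
  σ := σ
  initialState := v₀
  m := p.m

theorem outputs_of_runs [Fintype K] [Fintype σ] {p : Prog Γ σ} {k₀ k₁ : K} [Fintype (Γ k₀)]
    {v₀ : σ} {l : List (Γ k₀)} {l' : List (Γ k₁)} {T : ℕ}
    (h : Runs p v₀ (single k₀ l) v₀ (single k₁ l') T) :
    Nonempty (TM2OutputsInTime (toFinTM2 p k₀ k₁ v₀) l (some l') T) := by
  obtain ⟨t, ht, h⟩ := h
  refine ⟨⟨⟨t, ?_⟩, ht⟩⟩
  have := steps_iff_iterate.1 h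
  rw [← dite_eq_single, ← dite_eq_single] at this
  exact this

/-- A program that computes `f` on encoded arguments, within a polynomial number of steps. -/
theorem computableInPolyTime_of_runs [Fintype K] [Fintype σ] {α β αΓ βΓ : Type}
    {ea : α → List αΓ} {eb : β → List βΓ} {f : α → β} (p : Prog Γ σ) (k₀ k₁ : K)
    [Fintype (Γ k₀)] (v₀ : σ) (e₀ : Γ k₀ ≃ αΓ) (e₁ : Γ k₁ ≃ βΓ) (time : Polynomial ℕ)
    (h : ∀ a, Runs p v₀ (single k₀ ((ea a).map e₀.symm)) v₀ (single k₁ ((eb (f a)).map e₁.symm))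
      (time.eval (ea a).length)) :
    Nonempty (TM2ComputableInPolyTime ea eb f) :=
  ⟨{ tm := toFinTM2 p k₀ k₁ v₀
     inputAlphabet := e₀
     outputAlphabet := e₁
     time := time
     outputsFun := fun a => (outputs_of_runs (h a)).some }⟩

end StackProgram

/-! ### Unary arithmetic and the computation of the explicit part. -/

namespace StackProgram

open Turing Turing.TM2 Turing.TM2.Stmt HDGInstance

/-! ### Programs with unary counters

The stacks hold Booleans; a stack with `k` entries `true` represents the number `k`. The state
holds the symbol read last, or `none`. -/

section Counters

variable {K : Type} [DecidableEq K]

/-- Push `true` on each stack of the list `ks`, then do `q`. -/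
def pushTrue (ks : List K) (q : Stmt (fun _ : K => Bool) Unit (Option Bool)) :
    Stmt (fun _ : K => Bool) Unit (Option Bool) :=
  ks.foldr (fun k q => push k (fun _ => true) q) q

theorem stepAux_pushTrue (ks : List K) (q : Stmt (fun _ : K => Bool) Unit (Option Bool))
    (v : Option Bool) (S : K → List Bool) :
    stepAux (pushTrue ks q) v S =
      stepAux q v (fun j => List.replicate (ks.count j) true ++ S j) := by
  induction ks generalizing S with
  | nil => rfl
  | cons k ks ih =>
    change stepAux (pushTrue ks q) v (Function.update S k (true :: S k)) = _
    rw [ih]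
    congr 1
    funext j
    by_cases h : j = k
    · subst h
      simp only [Function.update_self, List.count_cons_self]
      rw [List.replicate_succ', List.append_assoc]; rfl
    · rw [Function.update_of_ne h, List.count_cons_of_ne (Ne.symm h)]

/-- Push a symbol and a number of `true`s. -/
def pushUnary (k : K) (n : ℕ) : Prog (fun _ : K => Bool) (Option Bool) :=
  rep (push k (fun _ => false) (pushTrue (List.replicate n k) halt))

/-- Add a constant to a counter. -/
def addConst (k : K) (n : ℕ) : Prog (fun _ : K => Bool) (Option Bool) :=
  rep (pushTrue (List.replicate n k) halt)

/-- Empty the stack `k`, and push a `true` on each stack of the list `ks` for each entry. -/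
def pour (k : K) (ks : List K) : Prog (fun _ : K => Bool) (Option Bool) :=
  rep (pop k (fun _ a => a)
    (branch Option.isSome (load (fun _ => none) (pushTrue ks (goto fun _ => ()))) halt))

theorem runs_pour (k : K) (ks : List K) (hk : k ∉ ks) (S : K → List Bool) :
    Runs (pour k ks) none S none
      (fun j => if j = k then [] else List.replicate ((S k).length * ks.count j) true ++ S j)
      ((S k).length + 1) := by
  induction hl : S k generalizing S with
  | nil =>
    refine Runs.rep_halt ?_
    simp only [stepAux, hl, List.head?_nil, Option.isSome_none, cond_false, List.tail_nil,
      List.length_nil, Nat.zero_mul, List.replicate_zero, List.nil_append]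
    congr 1
    funext j
    by_cases h : j = k
    · subst h; simp
    · simp [h]
  | cons b l ih =>
    have hcount : ks.count k = 0 := List.count_eq_zero.2 hk
    set S₁ : K → List Bool := fun j =>
      List.replicate (ks.count j) true ++ Function.update S k l j with hS₁
    have hk₁ : S₁ k = l := by simp [hS₁, hcount]
    have h := ih S₁ hk₁
    have h := Runs.rep_goto (v := none) (S := S) (v₁ := none) (S₁ := S₁) ?_ h
    rotate_left
    · simp only [stepAux, hl, List.head?_cons, Option.isSome_some, cond_true, stepAux_pushTrue,
        List.tail_cons]
      rfl
    · have hS : (fun j => if j = k then [] else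
          List.replicate (l.length * ks.count j) true ++ S₁ j) = fun j => if j = k then [] else
            List.replicate ((b :: l).length * ks.count j) true ++ S j := by
        funext j
        by_cases hj : j = k
        · simp [hj]
        · simp only [hj, if_false, hS₁, List.length_cons, Function.update_of_ne hj]
          rw [← List.append_assoc, ← List.replicate_add]
          congr 2
          ring
      rw [← hS]
      exact h

end Counters

/-- The stacks of the machine that writes instances: the input, four counters, the output. -/
def counterStacks (i : List Bool) (a b c d : ℕ) (o : List Bool) : Fin 6 → List Bool
  | 0 => i
  | 1 => List.replicate a true
  | 2 => List.replicate b true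
  | 3 => List.replicate c true
  | 4 => List.replicate d true
  | 5 => o

local notation "CProg" => Prog (fun _ : Fin 6 => Bool) (Option Bool)

theorem runs_addConst (n : ℕ) (i : List Bool) (a b c d : ℕ) (o : List Bool) :
    Runs (addConst 2 n : CProg) none (counterStacks i a b c d o) none
      (counterStacks i a (b + n) c d o) 1 := by
  refine Runs.rep_halt ?_
  rw [stepAux_pushTrue]
  simp only [stepAux]
  congr 1
  funext j
  fin_cases j <;> simp [counterStacks, List.count_replicate, add_comm]

theorem runs_pushUnary (n : ℕ) (i : List Bool) (a b c d : ℕ) (o : List Bool) :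
    Runs (pushUnary 5 n : CProg) none (counterStacks i a b c d o) none
      (counterStacks i a b c d (encodeUnary n ++ o)) 1 := by
  refine Runs.rep_halt ?_
  simp only [stepAux]
  rw [stepAux_pushTrue]
  simp only [stepAux]
  congr 1
  funext j
  fin_cases j <;> simp [counterStacks, List.count_replicate, encodeUnary]

theorem runs_pour_counterStacks {k : Fin 6} {ks : List (Fin 6)} {i i' : List Bool}
    {a b c d a' b' c' d' : ℕ} {o o' : List Bool} {T : ℕ} (hk : k ∉ ks)
    (hT : (counterStacks i a b c d o k).length + 1 ≤ T)
    (h : ∀ j, counterStacks i' a' b' c' d' o' j = if j = k then [] else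
      List.replicate ((counterStacks i a b c d o k).length * ks.count j) true ++
        counterStacks i a b c d o j) :
    Runs (pour k ks : CProg) none (counterStacks i a b c d o) none
      (counterStacks i' a' b' c' d' o') T := by
  rw [show counterStacks i' a' b' c' d' o' = _ from funext h]
  exact (runs_pour k ks hk _).mono hT

/-- Add the product of the counters `1` and `3` to the counter `2`. -/
def mulLoop : CProg :=
  loop (pop 3 (fun _ a => a) (branch Option.isSome (load (fun _ => none) (goto fun _ => ())) halt))
    (seq (pour 1 [2, 4]) (pour 4 [1]))

theorem runs_mulLoop (i : List Bool) (a b c : ℕ) (o : List Bool) :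
    Runs mulLoop none (counterStacks i a b c 0 o) none (counterStacks i a (b + c * a) 0 0 o)
      (c * (2 * a + 3) + 1) := by
  induction c generalizing b with
  | zero =>
    refine (Runs.loop_halt ?_).mono (by omega)
    simp only [stepAux]
    rw [show counterStacks i a b 0 0 o 3 = [] from rfl]
    simp only [List.head?_nil, Option.isSome_none, cond_false, List.tail_nil]
    congr 1
    funext j
    fin_cases j <;> simp [counterStacks]
  | succ c ih =>
    have h := Runs.loop_goto (s := (pop 3 (fun _ a => a) (branch Option.isSome
        (load (fun _ => none) (goto fun _ => ())) halt) :
        Stmt (fun _ : Fin 6 => Bool) Unit (Option Bool)))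
      (v := none) (v₁ := none) (S := counterStacks i a b (c + 1) 0 o)
      (S₁ := counterStacks i a b c 0 o) ?_
      (Runs.seq (p := pour 1 [2, 4]) (q := pour 4 [1]) (v₁ := none) (v' := none)
        (S₁ := counterStacks i 0 (b + a) c a o) (S' := counterStacks i a (b + a) c 0 o)
        (T₁ := a + 1) (T₂ := a + 1) ?_ ?_)
      (ih (b + a))
    · rw [show b + (c + 1) * a = b + a + c * a by ring]
      -- Each round costs one step for the test and `a + 1` for each of the two transfers, the
      -- second of which restores counter `1` from its copy.
      exact h.mono (by ring_nf; omega)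
    · simp only [stepAux]
      rw [show counterStacks i a b (c + 1) 0 o 3 = true :: List.replicate c true from rfl]
      simp only [List.head?_cons, Option.isSome_some, cond_true, List.tail_cons]
      congr 1
      funext j
      fin_cases j <;> simp [counterStacks]
    · refine runs_pour_counterStacks (by decide) (by simp [counterStacks]) fun j => ?_
      fin_cases j <;> simp [counterStacks, add_comm]
    · refine runs_pour_counterStacks (by decide) (by simp [counterStacks]) fun j => ?_
      fin_cases j <;> simp [counterStacks]

/-- Every polynomial can be evaluated in polynomial time, in unary. -/
theorem exists_runs_eval (p : Polynomial ℕ) : ∃ (P : CProg) (T : Polynomial ℕ), ∀ a : ℕ,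
    Runs P none (counterStacks [] a 0 0 0 []) none (counterStacks [] a (p.eval a) 0 0 [])
      (T.eval a) := by
  induction p using Polynomial.recOnHorner with
  | M0 => exact ⟨rep halt, 1, fun a => by simpa using Runs.rep_halt rfl⟩
  | MC p n _ _ ih =>
    obtain ⟨P, T, h⟩ := ih
    refine ⟨seq P (addConst 2 n), T + 1, fun a => ?_⟩
    have := (h a).seq (runs_addConst n [] a (p.eval a) 0 0 [])
    simpa using this
  | MX p _ ih =>
    obtain ⟨P, T, h⟩ := ih
    -- Horner step: the value found so far becomes the number of rounds, in counter `3`, and the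
    -- emptied counter `2` accumulates its product with `a`.
    refine ⟨seq P (seq (pour 2 [3]) mulLoop),
      T + ((p + 1) + (p * (2 * Polynomial.X + 3) + 1)), fun a => ?_⟩
    have h₁ : Runs (pour 2 [3] : CProg) none (counterStacks [] a (p.eval a) 0 0 []) none
        (counterStacks [] a 0 (p.eval a) 0 []) (p.eval a + 1) := by
      refine runs_pour_counterStacks (by decide) (by simp [counterStacks]) fun j => ?_
      fin_cases j <;> simp [counterStacks]
    have := (h a).seq (h₁.seq (runs_mulLoop [] a 0 (p.eval a) []))
    simpa using this

/-! ### Writing instances -/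

/-- The codes of `0, …, n - 1`. -/
def encodeRange (n : ℕ) : List Bool := ((List.range n).map encodeUnary).flatten

/-- Write the codes of the numbers below the counter `4`. -/
def writeRange : CProg :=
  loop (pop 4 (fun _ a => a) (branch Option.isSome (load (fun _ => none) (goto fun _ => ())) halt))
    (seq (pushUnary 5 0) (seq (pour 4 [3, 5]) (pour 3 [4])))

theorem runs_writeRange (i : List Bool) (a b d : ℕ) (o : List Bool) :
    Runs writeRange none (counterStacks i a b 0 d o) none
      (counterStacks i a b 0 0 (encodeRange d ++ o)) (d * (2 * d + 4) + 1) := by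
  induction d generalizing o with
  | zero =>
    refine (Runs.loop_halt ?_).mono (by omega)
    simp only [stepAux]
    rw [show counterStacks i a b 0 0 o 4 = [] from rfl]
    simp only [List.head?_nil, Option.isSome_none, cond_false, List.tail_nil]
    congr 1
    funext j
    fin_cases j <;> simp [counterStacks, encodeRange]
  | succ d ih =>
    have h := Runs.loop_goto (s := (pop 4 (fun _ a => a) (branch Option.isSome
        (load (fun _ => none) (goto fun _ => ())) halt) :
        Stmt (fun _ : Fin 6 => Bool) Unit (Option Bool)))
      (v := none) (v₁ := none) (S := counterStacks i a b 0 (d + 1) o)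
      (S₁ := counterStacks i a b 0 d o) ?_
      ((runs_pushUnary 0 i a b 0 d o).seq
        (Runs.seq (p := pour 4 [3, 5]) (q := pour 3 [4]) (v₁ := none) (v' := none)
          (S₁ := counterStacks i a b d 0 (encodeUnary d ++ o))
          (S' := counterStacks i a b 0 d (encodeUnary d ++ o))
          (T₁ := d + 1) (T₂ := d + 1) ?_ ?_))
      (ih (encodeUnary d ++ o))
    -- The output stack grows at its front, so the codes are written from the largest number
    -- downwards, and in each code the final `false` comes first.
    · rw [show encodeRange (d + 1) = encodeRange d ++ encodeUnary d by
        simp [encodeRange, List.range_succ], List.append_assoc]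
      exact h.mono (by ring_nf; omega)
    · simp only [stepAux]
      rw [show counterStacks i a b 0 (d + 1) o 4 = true :: List.replicate d true from rfl]
      simp only [List.head?_cons, Option.isSome_some, cond_true, List.tail_cons]
      congr 1
      funext j
      fin_cases j <;> simp [counterStacks]
    · refine runs_pour_counterStacks (by decide) (by simp [counterStacks]) fun j => ?_
      fin_cases j <;> simp [counterStacks, encodeUnary]
    · refine runs_pour_counterStacks (by decide) (by simp [counterStacks]) fun j => ?_
      fin_cases j <;> simp [counterStacks]

/-- The code of an instance with `n` agents of different colors, without a bound on the sizes of
coalitions, with at most three coalitions, at most `k` of them non-trivial. -/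
def instanceCode (n k : ℕ) : List Bool :=
  encodeUnary n ++ (encodeUnary n ++ (encodeUnary n ++ (encodeUnary 3 ++ (encodeUnary k ++
    encodeRange n))))

/-- The code of an instance whose size is given by a polynomial can be computed in polynomial
time. -/
theorem exists_runs_instanceCode (p : Polynomial ℕ) (k : ℕ) :
    ∃ (P : CProg) (T : Polynomial ℕ), ∀ x : List Bool,
      Runs P none (single 0 x) none (single 5 (instanceCode (p.eval x.length) k))
        (T.eval x.length) := by
  obtain ⟨P, T, h⟩ := exists_runs_eval p
  -- The code is written from back to front. Its three copies of `n` are produced while the number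
  -- is poured from counter `1` to `2`, back to `1`, and finally away, which leaves all counters
  -- empty.
  refine ⟨seq (pour 0 [1]) (seq P (seq (pour 1 []) (seq (pour 2 [1, 4]) (seq writeRange
    (seq (pushUnary 5 k) (seq (pushUnary 5 3) (seq (pushUnary 5 0) (seq (pour 1 [2, 5])
    (seq (pushUnary 5 0) (seq (pour 2 [1, 5]) (seq (pushUnary 5 0) (pour 1 [5])))))))))))),
    (Polynomial.X + 1) + (T + ((Polynomial.X + 1) + ((p + 1) + ((p * (2 * p + 4) + 1) +
    (1 + (1 + (1 + ((p + 1) + (1 + ((p + 1) + (1 + (p + 1)))))))))))), fun x => ?_⟩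
  have hx : single (Γ := fun _ : Fin 6 => Bool) 0 x = counterStacks x 0 0 0 0 [] := by
    funext j
    fin_cases j <;> rfl
  have ho : ∀ o, single (Γ := fun _ : Fin 6 => Bool) 5 o = counterStacks [] 0 0 0 0 o := by
    intro o
    funext j
    fin_cases j <;> rfl
  rw [hx, ho]
  obtain ⟨a, ha⟩ : ∃ a, x.length = a := ⟨_, rfl⟩
  rw [ha]
  generalize hn : p.eval a = n
  have h₀ : Runs (pour 0 [1] : CProg) none (counterStacks x 0 0 0 0 []) none
      (counterStacks [] a 0 0 0 []) (a + 1) := by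
    refine runs_pour_counterStacks (by decide) (by simp [counterStacks, ha]) fun j => ?_
    fin_cases j <;> simp [counterStacks, ha]
  have h₁ : Runs (pour 1 [] : CProg) none (counterStacks [] a n 0 0 []) none
      (counterStacks [] 0 n 0 0 []) (a + 1) := by
    refine runs_pour_counterStacks (by decide) (by simp [counterStacks]) fun j => ?_
    fin_cases j <;> simp [counterStacks]
  have h₂ : Runs (pour 2 [1, 4] : CProg) none (counterStacks [] 0 n 0 0 []) none
      (counterStacks [] n 0 0 n []) (n + 1) := by
    refine runs_pour_counterStacks (by decide) (by simp [counterStacks]) fun j => ?_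
    fin_cases j <;> simp [counterStacks]
  have h₃ : ∀ o, Runs (pour 1 [2, 5] : CProg) none
      (counterStacks [] n 0 0 0 (encodeUnary 0 ++ o)) none
      (counterStacks [] 0 n 0 0 (encodeUnary n ++ o)) (n + 1) := by
    intro o
    refine runs_pour_counterStacks (by decide) (by simp [counterStacks]) fun j => ?_
    fin_cases j <;> simp [counterStacks, encodeUnary]
  have h₄ : ∀ o, Runs (pour 2 [1, 5] : CProg) none
      (counterStacks [] 0 n 0 0 (encodeUnary 0 ++ o)) none
      (counterStacks [] n 0 0 0 (encodeUnary n ++ o)) (n + 1) := by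
    intro o
    refine runs_pour_counterStacks (by decide) (by simp [counterStacks]) fun j => ?_
    fin_cases j <;> simp [counterStacks, encodeUnary]
  have h₅ : ∀ o, Runs (pour 1 [5] : CProg) none
      (counterStacks [] n 0 0 0 (encodeUnary 0 ++ o)) none
      (counterStacks [] 0 0 0 0 (encodeUnary n ++ o)) (n + 1) := by
    intro o
    refine runs_pour_counterStacks (by decide) (by simp [counterStacks]) fun j => ?_
    fin_cases j <;> simp [counterStacks, encodeUnary]
  have hP := h a
  rw [hn] at hP
  have := h₀.seq (hP.seq (h₁.seq (h₂.seq ((runs_writeRange [] n 0 n []).seq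
    ((runs_pushUnary k _ _ _ _ _ _).seq ((runs_pushUnary 3 _ _ _ _ _ _).seq
    ((runs_pushUnary 0 _ _ _ _ _ _).seq ((h₃ _).seq ((runs_pushUnary 0 _ _ _ _ _ _).seq
    ((h₄ _).seq ((runs_pushUnary 0 _ _ _ _ _ _).seq (h₅ _))))))))))))
  rw [List.append_nil] at this
  refine this.mono (le_of_eq ?_)
  simp [hn]

end StackProgram

/-! ### Implementation of the preference oracle. -/

namespace StackProgram

open Turing Turing.TM2 Turing.TM2.Stmt HDGInstance BitGame

/-! ### The machine that answers preference queries -/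

/-- The registers: the symbol read last, the role of the agent, the profiles of the coalition
examined last and of the one examined before. -/
structure Registers where
  buffer : Option (Option Bool)
  agent : Fin 4
  cur : Profile
  prev : Profile
  deriving DecidableEq, Fintype

/-- The initial contents of the registers. -/
def Registers.init : Registers :=
  ⟨none, 0, ⟨false, false, false, false, false, false⟩, ⟨false, false, false, false, false, false⟩⟩

/-- The stacks of the machine: the unread input, the word `x` (reversed or not), the bits of a
coalition. -/
def queryStacks (a b c d : List (Option Bool)) : Fin 4 → List (Option Bool)
  | 0 => a
  | 1 => b
  | 2 => c
  | 3 => d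

section QueryStacks

variable (a b c d l : List (Option Bool))

@[simp] theorem queryStacks_zero : queryStacks a b c d 0 = a := rfl
@[simp] theorem queryStacks_one : queryStacks a b c d 1 = b := rfl
@[simp] theorem queryStacks_two : queryStacks a b c d 2 = c := rfl
@[simp] theorem queryStacks_three : queryStacks a b c d 3 = d := rfl

@[simp] theorem update_queryStacks_zero :
    Function.update (queryStacks a b c d) 0 l = queryStacks l b c d := by
  funext j; fin_cases j <;> simp

@[simp] theorem update_queryStacks_one :
    Function.update (queryStacks a b c d) 1 l = queryStacks a l c d := by
  funext j; fin_cases j <;> simp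

@[simp] theorem update_queryStacks_two :
    Function.update (queryStacks a b c d) 2 l = queryStacks a b l d := by
  funext j; fin_cases j <;> simp

@[simp] theorem update_queryStacks_three :
    Function.update (queryStacks a b c d) 3 l = queryStacks a b c l := by
  funext j; fin_cases j <;> simp

end QueryStacks

variable {K : Type} [DecidableEq K] {Γ : K → Type} {σ : Type}

@[simp] theorem single_self (k : K) (l : List (Γ k)) : single k l k = l := Function.update_self ..

@[simp] theorem update_single (k : K) (l l' : List (Γ k)) :
    Function.update (single k l) k l' = single k l' := Function.update_idem ..

theorem single_nil (k k' : K) : (single k [] : ∀ j, List (Γ j)) = single k' [] := by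
  simp only [single]
  rw [Function.update_eq_self_iff.2 rfl, Function.update_eq_self_iff.2 rfl]

/-- The alphabets of the machine that answers queries. -/
abbrev QueryAlphabet (Γ : K → Type) : K ⊕ Fin 4 → Type :=
  SumAlphabet Γ fun _ : Fin 4 => Option Bool

local notation "QStmt" => Stmt (QueryAlphabet Γ) Unit (σ × Registers)
local notation "QProg" => Prog (QueryAlphabet Γ) (σ × Registers)

/-- Remember the symbol read. -/
def store (v : σ × Registers) (a : Option (Option Bool)) : σ × Registers :=
  (v.1, { v.2 with buffer := a })

/-- Forget the symbol read. -/
def forget (v : σ × Registers) : σ × Registers := store v none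

/-- The bit read. -/
def lastBit (v : σ × Registers) : Bool := v.2.buffer == some (some true)

/-- Was a bit read? -/
def isBit (v : σ × Registers) : Bool := v.2.buffer.join.isSome

/-- Read bits from a stack, execute `act` for each of them, and `fin` at the end. -/
def scan (k : Fin 4) (act : QStmt → QStmt) (fin : QStmt) : QProg :=
  rep (pop (.inr k) store
    (branch isBit (act (load forget (goto fun _ => ()))) (load forget fin)))

/-- Move the bits of the stack `k` to the stack `k'`. -/
def move (k k' : Fin 4) : QProg := scan k (push (.inr k') fun v => some (lastBit v)) halt

variable {s : σ} {ag : Fin 4} {f f' : Profile} {S : ∀ k, List (Γ k)}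

theorem runs_move_input (x : List Bool) (a b c d : List (Option Bool)) :
    Runs (move 0 1 : QProg) (s, ⟨none, ag, f, f'⟩)
      (join S (queryStacks (x.map some ++ none :: a) b c d)) (s, ⟨none, ag, f, f'⟩)
      (join S (queryStacks a (x.reverse.map some ++ b) c d)) (x.length + 1) := by
  induction x generalizing b with
  | nil => exact Runs.rep_halt (by simp [isBit, store, forget])
  | cons y x ih =>
    refine Runs.rep_goto ?_ (ih (some y :: b)) |> fun h => by simpa [move, scan] using h
    cases y <;> simp [isBit, store, forget, lastBit]

theorem runs_move_back (x : List Bool) (a b d : List (Option Bool)) :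
    Runs (move 2 1 : QProg) (s, ⟨none, ag, f, f'⟩)
      (join S (queryStacks a b (x.map some) d)) (s, ⟨none, ag, f, f'⟩)
      (join S (queryStacks a (x.reverse.map some ++ b) [] d)) (x.length + 1) := by
  induction x generalizing b with
  | nil => exact Runs.rep_halt (by simp [isBit, store, forget])
  | cons y x ih =>
    refine Runs.rep_goto ?_ (ih (some y :: b)) |> fun h => by simpa [move, scan] using h
    cases y <;> simp [isBit, store, forget, lastBit]

/-- Read the number of an agent, and remember its role. -/
def readAgent : QProg :=
  rep (pop (.inr 0) store (branch lastBit
    (load (fun v => (v.1, { v.2 with agent := cap (v.2.agent + 1), buffer := none }))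
      (goto fun _ => ()))
    (pop (.inr 0) store (load forget halt))))

theorem runs_readAgent (j i : ℕ) (a b c d : List (Option Bool)) :
    Runs (readAgent : QProg) (s, ⟨none, cap j, f, f'⟩)
      (join S (queryStacks ((encodeUnary i).map some ++ none :: a) b c d))
      (s, ⟨none, cap (j + i), f, f'⟩) (join S (queryStacks a b c d)) (i + 1) := by
  induction i generalizing j with
  | zero => exact Runs.rep_halt (by simp [encodeUnary, store, forget, lastBit])
  | succ i ih =>
    rw [show j + (i + 1) = j + 1 + i by omega]
    refine Runs.rep_goto (v₁ := (s, ⟨none, cap (j + 1), f, f'⟩))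
      (S₁ := join S (queryStacks ((encodeUnary i).map some ++ none :: a) b c d)) ?_ (ih (j + 1))
    -- A counter saturating at `3` suffices, since all bits have the same role.
    have : cap ((cap j : ℕ) + 1) = cap (j + 1) := by
      ext; simp only [cap]; omega
    simp [encodeUnary, List.replicate_succ, store, lastBit, this]

/-- Read the first three bits of a coalition. -/
def readHead : QProg :=
  rep (load (fun v => (v.1, { v.2 with prev := v.2.cur }))
    (pop (.inr 0) (fun v a => (v.1, { v.2 with
      cur := ⟨a == some (some true), false, false, false, true, false⟩ }))
    (pop (.inr 0) (fun v a => (v.1, { v.2 with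
      cur := { v.2.cur with left := a == some (some true) } }))
    (pop (.inr 0) (fun v a => (v.1, { v.2 with
      cur := { v.2.cur with right := a == some (some true) } })) halt))))

theorem runs_readHead (y₀ y₁ y₂ : Bool) (a b c d : List (Option Bool)) :
    Runs (readHead : QProg) (s, ⟨none, ag, f, f'⟩)
      (join S (queryStacks (some y₀ :: some y₁ :: some y₂ :: a) b c d))
      (s, ⟨none, ag, ⟨y₀, y₁, y₂, false, true, false⟩, f⟩) (join S (queryStacks a b c d)) 1 :=
  Runs.rep_halt (by cases y₀ <;> cases y₁ <;> cases y₂ <;> simp)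

/-- Read the remaining bits of a coalition. -/
def readBits : QProg :=
  scan 0 (fun q => push (.inr 3) (fun v => some (lastBit v)) (load (fun v => (v.1, { v.2 with
    cur := { v.2.cur with
      some := v.2.cur.some || lastBit v, all := v.2.cur.all && lastBit v } })) q)) halt

/-- The condition `ha` says that the bits are followed by a separator or by the end of the input.
Both stop the scan, and the last `pop` consumes the separator if there is one, whence `a.tail`. -/
theorem runs_readBits (r : List Bool) (a b c d : List (Option Bool))
    (ha : a.head?.join = none) :
    Runs (readBits : QProg) (s, ⟨none, ag, f, f'⟩)
      (join S (queryStacks (r.map some ++ a) b c d))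
      (s, ⟨none, ag, { f with some := f.some || r.any id, all := f.all && r.all id }, f'⟩)
      (join S (queryStacks a.tail b c (r.reverse.map some ++ d))) (r.length + 1) := by
  induction r generalizing d f with
  | nil =>
    refine Runs.rep_halt ?_
    simp [isBit, store, forget, ha]
  | cons y r ih =>
    refine Runs.rep_goto ?_ ((ih (f := { f with some := f.some || y, all := f.all && y })
      (some y :: d))) |> fun h => by simpa [readBits, scan, Bool.or_assoc, Bool.and_assoc] using h
    cases y <;> simp [isBit, store, forget, lastBit]

/-- Remove the last bits, up to and including the last `true`. -/
def strip : QProg :=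
  rep (pop (.inr 3) store (branch (fun v => v.2.buffer == some (some false))
    (load forget (goto fun _ => ())) (load forget halt)))

theorem runs_strip (r : List Bool) (a b c : List (Option Bool)) :
    Runs (strip : QProg) (s, ⟨none, ag, f, f'⟩) (join S (queryStacks a b c (r.map some)))
      (s, ⟨none, ag, f, f'⟩)
      (join S (queryStacks a b c ((r.dropWhile (!·)).tail.map some))) (r.length + 1) := by
  induction r with
  | nil => exact Runs.rep_halt (by simp [store, forget])
  | cons y r ih =>
    cases y
    · exact Runs.rep_goto (v₁ := (s, ⟨none, ag, f, f'⟩))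
        (S₁ := join S (queryStacks a b c (r.map some)))
        (by simp [store, forget]) (by simpa [strip] using ih)
    · exact (Runs.rep_halt (by simp [store, forget])).mono (by simp)

variable {k₀ k₁ : K} (e₀ : Γ k₀ ≃ Option Bool) (e₁ : Γ k₁ ≃ Bool)

/-- Write a certificate on the input stack of the verifier. -/
def writeCertificate : QProg :=
  scan 3 (push (.inl k₀) fun v => e₀.symm (some (lastBit v))) (push (.inl k₀)
    (fun _ => e₀.symm none) halt)

theorem runs_writeCertificate (w : List Bool) (l : List (Γ k₀)) (a b c : List (Option Bool)) :
    Runs (writeCertificate e₀ : QProg) (s, ⟨none, ag, f, f'⟩)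
      (join (single k₀ l) (queryStacks a b c (w.map some))) (s, ⟨none, ag, f, f'⟩)
      (join (single k₀ (e₀.symm none :: (w.reverse.map fun y => e₀.symm (some y)) ++ l))
        (queryStacks a b c [])) (w.length + 1) := by
  induction w generalizing l with
  | nil => exact Runs.rep_halt (by simp [isBit, store, forget])
  | cons y w ih =>
    refine Runs.rep_goto ?_ (ih (e₀.symm (some y) :: l)) |> fun h => by
      simpa [writeCertificate, scan] using h
    cases y <;> simp [isBit, store, forget, lastBit]

/-- Write the word `x` on the input stack of the verifier. -/
def writeWord : QProg :=
  scan 1 (fun q => push (.inl k₀) (fun v => e₀.symm (some (lastBit v)))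
    (push (.inr 2) (fun v => some (lastBit v)) q)) halt

theorem runs_writeWord (x : List Bool) (l : List (Γ k₀)) (a c d : List (Option Bool)) :
    Runs (writeWord e₀ : QProg) (s, ⟨none, ag, f, f'⟩)
      (join (single k₀ l) (queryStacks a (x.map some) c d)) (s, ⟨none, ag, f, f'⟩)
      (join (single k₀ ((x.reverse.map fun y => e₀.symm (some y)) ++ l))
        (queryStacks a [] (x.reverse.map some ++ c) d)) (x.length + 1) := by
  induction x generalizing l c with
  | nil => exact Runs.rep_halt (by simp [isBit, store, forget])
  | cons y w ih =>
    refine Runs.rep_goto ?_ (ih (e₀.symm (some y) :: l) (some y :: c)) |> fun h => by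
      simpa [writeWord, scan] using h
    cases y <;> simp [isBit, store, forget, lastBit]

/-- Read the answer of the verifier. -/
def readAnswer : QProg :=
  rep (pop (.inl k₁) (fun v a => (v.1, { v.2 with
    cur := { v.2.cur with accepted := (a.map e₁).getD false } })) halt)

theorem runs_readAnswer (y : Bool) (S₀ : Fin 4 → List (Option Bool)) :
    Runs (readAnswer e₁ : QProg) (s, ⟨none, ag, f, f'⟩) (join (single k₁ [e₁.symm y]) S₀)
      (s, ⟨none, ag, { f with accepted := y }, f'⟩) (join (single k₁ []) S₀) 1 :=
  Runs.rep_halt (by simp)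

/-- Compare the two profiles, clean up and write the answer. -/
def writeAnswer (s₀ : σ) (u : Fin 4 → Profile → ℕ) : QProg :=
  scan 1 id (push (.inl k₁)
    (fun v => e₁.symm (decide (u v.2.agent v.2.cur ≤ u v.2.agent v.2.prev)))
    (load (fun _ => (s₀, Registers.init)) halt))

theorem runs_writeAnswer (s₀ : σ) (u : Fin 4 → Profile → ℕ) (x : List Bool)
    (a c d : List (Option Bool)) :
    Runs (writeAnswer e₁ s₀ u : QProg) (s, ⟨none, ag, f, f'⟩)
      (join (single k₁ []) (queryStacks a (x.map some) c d)) (s₀, Registers.init)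
      (join (single k₁ [e₁.symm (decide (u ag f ≤ u ag f'))]) (queryStacks a [] c d))
      (x.length + 1) := by
  induction x with
  | nil => exact Runs.rep_halt (by simp [isBit, store, forget])
  | cons y w ih =>
    exact Runs.rep_goto (by cases y <;> simp [isBit, store, forget]) ih

/-- The certificate represented by a word: everything before the last `true`. -/
def certificate (r : List Bool) : List Bool := (r.reverse.dropWhile (!·)).tail.reverse

/-- Read a coalition from the input, and run the verifier `p` on its set of bits. -/
def examine (p : Prog Γ σ) : QProg :=
  seq readHead (seq readBits (seq strip (seq (writeCertificate e₀) (seq (writeWord e₀)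
    (seq (move 2 1) (seq (lift _ _ p) (readAnswer e₁)))))))

/-- The program `p`, started and halting in the state `s`, decides `V` on the encodings of pairs of
words in time `T`. -/
def Verifies (p : Prog Γ σ) (s : σ) (V : List Bool × List Bool → Bool) (T : ℕ → ℕ) : Prop :=
  ∀ x w, Runs p s (single k₀ ((encodePair (x, w)).map e₀.symm)) s
    (single k₁ [e₁.symm (V (x, w))]) (T (encodePair (x, w)).length)

theorem length_certificate_le (r : List Bool) : (certificate r).length ≤ r.length - 1 := by
  rw [certificate, List.length_reverse, List.length_tail]
  have := (List.dropWhile_suffix (p := (!·)) (l := r.reverse)).length_le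
  rw [List.length_reverse] at this
  omega

variable {e₀ e₁}

/-- The bits are stored in reverse, so `strip` finds the padding on top, and copying what remains to
the verifier's stack restores the order. The word `x` is also kept reversed for this purpose; it is
saved on stack `2` while being copied and then moved back, so that a second coalition can be
examined. -/
theorem runs_examine {p : Prog Γ σ} {V : List Bool × List Bool → Bool} {T : ℕ → ℕ}
    (hp : Verifies e₀ e₁ p s V T) (hT : Monotone T) (x : List Bool) (y₀ y₁ y₂ : Bool)
    (r : List Bool) (a : List (Option Bool)) (ha : a.head?.join = none) :
    Runs (examine e₀ e₁ p) (s, ⟨none, ag, f, f'⟩)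
      (join (single k₀ []) (queryStacks (some y₀ :: some y₁ :: some y₂ :: (r.map some ++ a))
        (x.reverse.map some) [] []))
      (s, ⟨none, ag, wordProfile (fun r => V (x, certificate r)) y₀ y₁ y₂ r, f⟩)
      (join (single k₀ []) (queryStacks a.tail (x.reverse.map some) [] []))
      (T (x.length + r.length + 1) + 2 * x.length + 3 * r.length + 7) := by
  set X := x.reverse.map some with hX
  set g := wordProfile (fun _ => false) y₀ y₁ y₂ r with hg
  set w := certificate r with hw
  have h₁ := runs_readHead (s := s) (ag := ag) (f := f) (f' := f')
    (S := (single k₀ [] : ∀ k, List (Γ k))) y₀ y₁ y₂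
    (r.map some ++ a) X [] []
  have h₂ : Runs (readBits : QProg) (s, ⟨none, ag, ⟨y₀, y₁, y₂, false, true, false⟩, f⟩)
      (join (single k₀ []) (queryStacks (r.map some ++ a) X [] [])) (s, ⟨none, ag, g, f⟩)
      (join (single k₀ []) (queryStacks a.tail X [] (r.reverse.map some))) (r.length + 1) := by
    simpa [hg, wordProfile] using runs_readBits (s := s) (ag := ag)
      (f := ⟨y₀, y₁, y₂, false, true, false⟩) (f' := f)
      (S := (single k₀ [] : ∀ k, List (Γ k))) r a X [] [] ha
  have h₃ := runs_strip (s := s) (ag := ag) (f := g) (f' := f)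
    (S := (single k₀ [] : ∀ k, List (Γ k))) r.reverse a.tail
    X []
  have h₄ := runs_writeCertificate (s := s) (ag := ag) (f := g) (f' := f) e₀
    (r.reverse.dropWhile (!·)).tail [] a.tail X []
  have h₅ := runs_writeWord (s := s) (ag := ag) (f := g) (f' := f) e₀ x.reverse
    (e₀.symm none :: (w.map fun y => e₀.symm (some y)) ++ []) a.tail [] []
  have h₆ : Runs (move 2 1 : QProg) (s, ⟨none, ag, g, f⟩)
      (join (single k₀ ((encodePair (x, w)).map e₀.symm))
        (queryStacks a.tail [] (x.reverse.reverse.map some ++ []) [])) (s, ⟨none, ag, g, f⟩)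
      (join (single k₀ ((encodePair (x, w)).map e₀.symm)) (queryStacks a.tail X [] []))
      (x.length + 1) := by
    simpa [hX] using runs_move_back (s := s) (ag := ag) (f := g) (f' := f)
      (S := single k₀ ((encodePair (x, w)).map e₀.symm)) x a.tail [] []
  have hpair : (x.reverse.reverse.map fun y => e₀.symm (some y)) ++
      (e₀.symm none :: (w.map fun y => e₀.symm (some y)) ++ []) =
      (encodePair (x, w)).map e₀.symm := by
    simp [encodePair, Function.comp_def]
  rw [hpair] at h₅
  have h₇ := (hp x w).lift (Γ₀ := fun _ : Fin 4 => Option Bool) (⟨none, ag, g, f⟩ : Registers)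
    (queryStacks a.tail X [] [])
  have h₈ := runs_readAnswer (s := s) (ag := ag) (f := g) (f' := f) e₁ (V (x, w))
    (queryStacks a.tail X [] [])
  -- Once the answer is read, all stacks of the verifier are empty, as at the start.
  rw [single_nil k₁ k₀] at h₈
  refine (h₁.seq (h₂.seq (h₃.seq (h₄.seq (h₅.seq (h₆.seq (h₇.seq h₈))))))).mono ?_
  have hle : w.length ≤ r.length - 1 := length_certificate_le r
  have hlen : (encodePair (x, w)).length ≤ x.length + r.length + 1 := by
    simp only [encodePair, List.length_append, List.length_map, List.length_cons]
    omega
  have hcert : (r.reverse.dropWhile (!·)).tail.length ≤ r.length := by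
    rw [← List.length_reverse]
    exact hle.trans (Nat.sub_le _ _)
  have := hT hlen
  simp only [List.length_reverse]
  omega

/-- The program that answers queries about games whose preferences are given by the values `u`. -/
def answerQuery (p : Prog Γ σ) (s : σ) (u : Fin 4 → Profile → ℕ) : QProg :=
  seq (move 0 1) (seq readAgent (seq (examine e₀ e₁ p) (seq (examine e₀ e₁ p)
    (writeAnswer e₁ s u))))

theorem runs_answerQuery {p : Prog Γ σ} {V : List Bool × List Bool → Bool} {T : ℕ → ℕ}
    (hp : Verifies e₀ e₁ p s V T) (hT : Monotone T) (u : Fin 4 → Profile → ℕ) (x : List Bool)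
    (i : ℕ) (y₀ y₁ y₂ : Bool) (r : List Bool) (z₀ z₁ z₂ : Bool) (t : List Bool) :
    Runs (answerQuery (e₀ := e₀) (e₁ := e₁) p s u) (s, Registers.init)
      (single (Γ := QueryAlphabet Γ) (.inr 0) (x.map some ++ none ::
        ((encodeUnary i).map some ++ none :: (y₀ :: y₁ :: y₂ :: r).map some ++
          none :: (z₀ :: z₁ :: z₂ :: t).map some))) (s, Registers.init)
      (single (Γ := QueryAlphabet Γ) (.inl k₁) [e₁.symm (decide
        (u (cap i) (wordProfile (fun r => V (x, certificate r)) z₀ z₁ z₂ t) ≤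
          u (cap i) (wordProfile (fun r => V (x, certificate r)) y₀ y₁ y₂ r)))])
      (T (x.length + r.length + 1) + T (x.length + t.length + 1) + 6 * x.length + i +
        3 * r.length + 3 * t.length + 17) := by
  set A : Profile := wordProfile (fun r => V (x, certificate r)) y₀ y₁ y₂ r
  set B : Profile := wordProfile (fun r => V (x, certificate r)) z₀ z₁ z₂ t
  set o : Profile := ⟨false, false, false, false, false, false⟩
  have hstart : ∀ l, single (Γ := QueryAlphabet Γ) (.inr 0) l =
      join (single k₀ []) (queryStacks l [] [] []) := by
    intro l
    have h : (fun _ => [] : ∀ j, List (QueryAlphabet Γ j)) =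
        join (single k₀ []) (queryStacks [] [] [] []) := by
      funext j
      rcases j with j | j
      · simp only [join_inl, single]
        rw [Function.update_eq_self_iff.2 rfl]
      · fin_cases j <;> rfl
    rw [single, h, update_join_inr, update_queryStacks_zero]
  have hend : ∀ l, single (Γ := QueryAlphabet Γ) (.inl k₁) l =
      join (single k₁ l) (queryStacks [] [] [] []) := by
    intro l
    have h : (fun _ => [] : ∀ j, List (QueryAlphabet Γ j)) =
        join (single k₁ []) (queryStacks [] [] [] []) := by
      funext j
      rcases j with j | j
      · simp only [join_inl, single]
        rw [Function.update_eq_self_iff.2 rfl]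
      · fin_cases j <;> rfl
    rw [single, h, update_join_inl, update_single]
  rw [hstart, hend]
  have h₁ := runs_move_input (s := s) (ag := cap 0) (f := o) (f' := o)
    (S := (single k₀ [] : ∀ k, List (Γ k))) x
    ((encodeUnary i).map some ++ none :: ((y₀ :: y₁ :: y₂ :: r).map some ++
          none :: (z₀ :: z₁ :: z₂ :: t).map some)) [] [] []
  have h₂ := runs_readAgent (s := s) (f := o) (f' := o)
    (S := (single k₀ [] : ∀ k, List (Γ k))) 0 i
    ((y₀ :: y₁ :: y₂ :: r).map some ++ none :: (z₀ :: z₁ :: z₂ :: t).map some)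
    (x.reverse.map some ++ []) [] []
  rw [Nat.zero_add] at h₂
  have h₃ := runs_examine (ag := cap i) (f := o) (f' := o) hp hT x y₀ y₁ y₂ r
    (none :: (z₀ :: z₁ :: z₂ :: t).map some) rfl
  -- The second examination moves `A` to the register `prev`; the comparison is then between `cur =
  -- B` and `prev = A`.
  have h₄ := runs_examine (ag := cap i) (f := A) (f' := o) hp hT x z₀ z₁ z₂ t [] rfl
  have h₅ := runs_writeAnswer (s := s) (ag := cap i) (f := B) (f' := A) e₁ s u x.reverse [] [] []
  rw [single_nil k₁ k₀] at h₅
  rw [List.append_nil] at h₁ h₂ h₄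
  have h := h₁.seq (h₂.seq (h₃.seq (h₄.seq h₅)))
  simp only [List.length_reverse] at h
  rw [List.append_assoc, List.cons_append]
  exact h.mono (by omega)

end StackProgram

open Turing Turing.TM2 HDGInstance BitGame StackProgram

namespace BitGame

/-! ### The reduction -/

theorem polynomial_eval_monotone (p : Polynomial ℕ) : Monotone fun n => p.eval n := by
  intro a b h
  simp only [Polynomial.eval_eq_sum_range]
  exact Finset.sum_le_sum fun i _ => Nat.mul_le_mul le_rfl (Nat.pow_le_pow_left h i)

/-- Is the certificate represented by a word accepted by the verifier? -/
def accepts (V : List Bool × List Bool → Bool) (x r : List Bool) : Bool := V (x, certificate r)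

/-- The number of bits is fixed while certificates vary in length, so a `true` marks the end of the
certificate. The marker also makes the set of bits nonempty, even for an empty certificate. -/
theorem exists_word_iff_exists_certificate (V : List Bool × List Bool → Bool) (x : List Bool)
    (b : ℕ) : (∃ r : List Bool, r.length = b + 1 ∧ r.any id = true ∧ accepts V x r = true) ↔
      ∃ w : List Bool, w.length ≤ b ∧ V (x, w) = true := by
  constructor
  · rintro ⟨r, hr, -, h⟩
    exact ⟨certificate r, (length_certificate_le r).trans (by omega), h⟩
  · rintro ⟨w, hw, h⟩
    refine ⟨w ++ true :: List.replicate (b - w.length) false, ?_, by simp, ?_⟩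
    · simp only [List.length_append, List.length_cons, List.length_replicate]
      omega
    have : certificate (w ++ true :: List.replicate (b - w.length) false) = w := by
      have hd : ∀ n (l : List Bool), (List.replicate n false ++ true :: l).dropWhile (!·) =
          true :: l := by
        intro n l
        induction n with
        | zero => simp
        | succ n ih => simp [List.replicate_succ, ih]
      simp [certificate, hd]
    rw [accepts, this, h]

variable (V : List Bool × List Bool → Bool) (b : Polynomial ℕ) (u : Fin 4 → Profile → ℕ) (k : ℕ)

/-- The game for the word `x`, where `b` bounds the lengths of certificates. -/
def reduction (x : List Bool) : HDGInstance :=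
  game (b.eval x.length + 1) (accepts V x) u k

theorem encode_game (m : ℕ) (acc : List Bool → Bool) :
    (game m acc u k).encode = instanceCode (m + 3) k := by
  have h : (List.ofFn fun i : Fin (m + 3) => encodeUnary i).flatten = encodeRange (m + 3) := by
    rw [encodeRange, ← List.map_coe_finRange_eq_range, List.map_map, List.ofFn_eq_map]
    rfl
  change encodeUnary (m + 3) ++ encodeUnary (m + 3) ++ encodeUnary (m + 3) ++ encodeUnary 3 ++
    encodeUnary k ++ (List.ofFn fun i : Fin (m + 3) => encodeUnary i).flatten = _
  rw [h]
  simp only [instanceCode, List.append_assoc]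

variable {k} in
theorem encodeQuery_game {m : ℕ} {acc : List Bool → Bool} (i : Fin (m + 3))
    {X Y : Finset (Fin (m + 3))} (hX : X.Nonempty) (hY : Y.Nonempty) :
    (game m acc u k).encodeQuery (i, ⟨X, hX⟩, ⟨Y, hY⟩) =
      (encodeUnary i).map some ++
        none :: (decide (0 ∈ X) :: decide (1 ∈ X) :: decide (2 ∈ X) :: bits X).map some ++
        none :: (decide (0 ∈ Y) :: decide (1 ∈ Y) :: decide (2 ∈ Y) :: bits Y).map some := by
  have h : ∀ Z : Finset (Fin (m + 3)), (List.ofFn fun i : Fin (m + 3) => decide (i ∈ Z)) =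
      decide (0 ∈ Z) :: decide (1 ∈ Z) :: decide (2 ∈ Z) :: bits Z := fun Z => by
    rw [List.ofFn_succ, List.ofFn_succ, List.ofFn_succ]
    rfl
  rw [← h, ← h]
  rfl

variable {k} in
theorem oracle_game {m : ℕ} {acc : List Bool → Bool} (i : Fin (m + 3))
    {X Y : Finset (Fin (m + 3))} (hX : X.Nonempty) (hY : Y.Nonempty) :
    (game m acc u k).oracle (i, ⟨X, hX⟩, ⟨Y, hY⟩) =
      decide (u (cap i) (profile acc Y) ≤ u (cap i) (profile acc X)) :=
  decide_eq_decide.2 (weakPref_iff acc u k i _ _)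

theorem polyTimeConstructible_reduction
    (hV : Nonempty (TM2ComputableInPolyTime encodePair (fun b : Bool => [b]) V)) :
    PolyTimeConstructible (reduction V b u k) := by
  constructor
  -- There are `b + 1` bits and three further agents.
  · obtain ⟨P, T, h⟩ := exists_runs_instanceCode (b + 4) k
    refine computableInPolyTime_of_runs P 0 5 none (Equiv.refl Bool) (Equiv.refl Bool) T fun x => ?_
    have := h x
    rw [reduction, encode_game]
    simpa [add_assoc] using this
  · obtain ⟨hV⟩ := hV
    have hp : Verifies hV.inputAlphabet hV.outputAlphabet (ofFinTM2 hV.tm) hV.tm.initialState V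
        fun n => hV.time.eval n := fun x w => runs_of_outputs (hV.outputsFun (x, w))
    have := hV.tm.kFin
    have := hV.tm.σFin
    refine computableInPolyTime_of_runs (Γ := QueryAlphabet hV.tm.Γ)
      (answerQuery (e₀ := hV.inputAlphabet) (e₁ := hV.outputAlphabet) (ofFinTM2 hV.tm)
        hV.tm.initialState u) (.inr 0) (.inl hV.tm.k₁) (hV.tm.initialState, Registers.init)
      (Equiv.refl _) hV.outputAlphabet (2 * hV.time + 12 * Polynomial.X + 17) ?_
    rintro ⟨x, (i : Fin (b.eval x.length + 1 + 3)), ⟨X, hX⟩, ⟨Y, hY⟩⟩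
    change Finset (Fin (b.eval x.length + 1 + 3)) at X Y
    -- The encoded query and the oracle's answer are replaced by an arbitrary word and bit with the
    -- right values, which removes the dependence of their types on the game.
    suffices h : ∀ (q : List (Option Bool)) (o : Bool), q = (encodeUnary i).map some ++
        none :: (decide (0 ∈ X) :: decide (1 ∈ X) :: decide (2 ∈ X) :: bits X).map some ++
        none :: (decide (0 ∈ Y) :: decide (1 ∈ Y) :: decide (2 ∈ Y) :: bits Y).map some →
        o = decide (u (cap i) (profile (accepts V x) Y) ≤ u (cap i) (profile (accepts V x) X)) →
        Runs (Γ := QueryAlphabet hV.tm.Γ) (answerQuery (e₀ := hV.inputAlphabet)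
          (e₁ := hV.outputAlphabet) (ofFinTM2 hV.tm) hV.tm.initialState u)
          (hV.tm.initialState, Registers.init) (single (Γ := QueryAlphabet hV.tm.Γ) (.inr 0)
            ((x.map some ++ none :: q).map id)) (hV.tm.initialState, Registers.init)
          (single (Γ := QueryAlphabet hV.tm.Γ) (.inl hV.tm.k₁) [hV.outputAlphabet.symm o])
          ((2 * hV.time + 12 * Polynomial.X + 17).eval (x.map some ++ none :: q).length) from
      h _ _ (encodeQuery_game u i hX hY) (oracle_game u i hX hY)
    rintro _ _ rfl rfl
    rw [List.map_id]
    refine (runs_answerQuery hp (polynomial_eval_monotone _) u x i (decide (0 ∈ X))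
      (decide (1 ∈ X)) (decide (2 ∈ X)) (bits X) (decide (0 ∈ Y)) (decide (1 ∈ Y))
      (decide (2 ∈ Y)) (bits Y)).mono ?_
    have hbits : ∀ Z : Finset (Fin (b.eval x.length + 1 + 3)),
        (bits Z).length = b.eval x.length + 1 := fun Z => by rw [bits, List.length_ofFn]
    generalize hl : (x.map some ++ none :: _).length = l
    simp only [List.length_append, List.length_cons, List.length_map, hbits, encodeUnary,
      List.length_replicate, List.length_nil] at hl
    -- The encoded query contains `x`, the agent's number in unary and both words of bits, so its
    -- length bounds the verifier's input and every linear term of the running time.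
    have hmono : hV.time.eval (x.length + (b.eval x.length + 1) + 1) ≤ hV.time.eval l :=
      polynomial_eval_monotone _ (by omega)
    simp only [hbits, Polynomial.eval_add, Polynomial.eval_mul, Polynomial.eval_X,
      Polynomial.eval_ofNat]
    omega

end BitGame

theorem mainTheorem8 :
    NPHardRestricted HDGInstance.NashYes
      (fun I => I.numTypes = 2 ∧ I.maxNontrivial = 2 ∧ I.maxCoalitions = 3) ∧
    NPHardRestricted HDGInstance.IndividualYes
      (fun I => I.numTypes = 4 ∧ I.maxNontrivial = 3 ∧ I.maxCoalitions = 3) := by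
  constructor
  · rintro L ⟨p, V, hV, hL⟩
    refine ⟨reduction V p (fun c f => f.value c) 2, polyTimeConstructible_reduction _ _ _ _ hV,
      fun x => ⟨numTypes_value _ _ (Nat.succ_pos _), rfl, rfl⟩, fun x => ?_⟩
    rw [hL, ← exists_word_iff_exists_certificate]
    exact (exists_word_iff_nashYes (fun _ _ _ => rfl) (Nat.succ_pos _) le_rfl).symm
  · rintro L ⟨p, V, hV, hL⟩
    -- With at most three coalitions, the bound `3` on the non-trivial ones is no restriction.
    refine ⟨reduction V p (fun c f => f.ownValue c) 3, polyTimeConstructible_reduction _ _ _ _ hV,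
      fun x => ⟨numTypes_ownValue _ _ (Nat.succ_pos _), rfl, rfl⟩, fun x => ?_⟩
    rw [hL, ← exists_word_iff_exists_certificate]
    exact (exists_word_iff_individualYes (fun c f h => by simp [Profile.ownValue, h])
      (Nat.succ_pos _) (by norm_num)).symm
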